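/- Let $M$ be a smooth $n$-manifold and $F:TM\to[0,\infty)$ a Finsler metric: $F$ is $C^\infty$ on $TM\setminus\{0\}$, $F(x,cy)=cF(x,y)$ for $c>0$, and $g_{ij}(x,y)=\frac12[F^2]_{y^iy^j}(x,y)$ is positive definite for $y\neq0$. Let $(g^{ij})=(g_{ij})^{-1}$, $C_{ijk}=\frac14[F^2]_{y^iy^jy^k}$, $C^r_{ij}=g^{rl}C_{lij}$, $G^i=\frac14g^{il}\{[F^2]_{x^ky^l}y^k-[F^2]_{x^l}\}$, $N^i_j=\frac{\partial G^i}{\partial y^j}$, $\frac{\delta}{\delta x^i}=\frac{\partial}{\partial x^i}-N_i^m\frac{\partial}{\partial y^m}$, and let $\Gamma^i_{jk}=\frac12g^{il}\big(\frac{\delta g_{lj}}{\delta x^k}+\frac{\delta g_{lk}}{\delta x^j}-\frac{\delta g_{jk}}{\delta x^l}\big)$ be the coefficients of the Chern connection. For a function $u=u(x)$ put $u_{|i}=\frac{\delta u}{\delta x^i}=\frac{\partial u}{\partial x^i}$ and $u_{|i|j}(x,y)=\frac{\delta u_{|i}}{\delta x^j}-\Gamma^k_{ij}(x,y)u_{|k}$.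 For a vector field $V=V^i(x)\frac{\partial}{\partial x^i}$ on an open subset of $M$, its complete lift is $\hat V=V^i\frac{\partial}{\partial x^i}+y^m\frac{\partial V^i}{\partial x^m}\frac{\partial}{\partial y^i}$, and $$\mathcal L_{\hat V}g_{ij}=\hat V(g_{ij})+\frac{\partial V^a}{\partial x^i}g_{aj}+\frac{\partial V^a}{\partial x^j}g_{ia}.$$ Let $u$ be a $C^2$ function on $M$. For every $x\in M$ the Legendre transformation $T_xM\to T_x^*M$, $y\mapsto g_y(y,\cdot)$ (with $0\mapsto0$), is bijective, so that the gradient $\nabla u(x)$, the preimage of $du_x$, is well defined, and $\nabla u$ is a $C^1$ vector field on the open set $M_u=\{x\in M: du_x\neq0\}$. In every smooth chart of $M$, at every point $x\in M_u$ of its domain, the Hessian matrix $\mathrm{Hess}(u)=(u_{|i|j}(x,\nabla u))$ satisfies $$\mathrm{Hess}(u)=\tfrac12\,\mathcal L_{\widehat{\nabla u}}g(x,\nabla u)-\Big((\nabla^mu)\,u_{|r|m}(x,\nabla u)\,C^r_{ij}(x,\nabla u)\Big),$$ where $\mathcal L_{\widehat{\nabla u}}g(x,\nabla u)$ is the matrix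 of the values $\mathcal L_{\widehat{\nabla u}}g_{ij}$ at the point $(x,\nabla u(x))$ and $\nabla u=(\nabla^iu)\frac{\partial}{\partial x^i}$. -/

import Mathlib

open scoped Manifold ContDiff

noncomputable section

namespace Finsler

/-! ### Finsler manifolds, Legendre transformation, gradient -/

/-- The fundamental tensor `g_v(a, b) = ½ ∂²/∂s∂t F²(v + s a + t b)` at `s = t = 0` of a function
`f = F_x` on a tangent space. -/
def fundTensor {E : Type*} [NormedAddCommGroup E] [NormedSpace ℝ E] (f : E → ℝ) (v : E) :
    E →L[ℝ] E →L[ℝ] ℝ :=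
  (1 / 2 : ℝ) • fderiv ℝ (fderiv ℝ (fun w => f w ^ 2)) v

/-- A Finsler metric on a smooth `n`-manifold `M`: a non-negative function on `TM`, smooth off the
zero section, whose restriction to each tangent space is a Minkowski function
(positively homogeneous of degree one, with positive definite fundamental tensor). Neither
connectedness of `M` nor reversibility of the metric is required. -/
structure FinslerMetric (n : ℕ) (M : Type*) [TopologicalSpace M]
    [ChartedSpace (EuclideanSpace ℝ (Fin n)) M] [IsManifold (𝓡 n) ∞ M] where
  /-- the metric as a function on the tangent bundle -/
  toFun : TangentBundle (𝓡 n) M → ℝ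
  nonneg : ∀ p, 0 ≤ toFun p
  smooth : ContMDiffOn (𝓡 n).tangent 𝓘(ℝ, ℝ) ∞ toFun {p | p.2 ≠ 0}
  homogeneous : ∀ (x : M) (v : TangentSpace (𝓡 n) x) (c : ℝ), 0 < c →
    toFun ⟨x, c • v⟩ = c * toFun ⟨x, v⟩
  posDef : ∀ (x : M) (v w : EuclideanSpace ℝ (Fin n)), v ≠ 0 → w ≠ 0 →
    0 < fundTensor (fun z : EuclideanSpace ℝ (Fin n) => toFun ⟨x, z⟩) v w w

section Manifold

variable {n : ℕ} {M : Type*} [TopologicalSpace M] [ChartedSpace (EuclideanSpace ℝ (Fin n)) M]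

/-- The differential `du_x ∈ T_x^* M`. -/
def differential (u : M → ℝ) (x : M) : TangentSpace (𝓡 n) x →L[ℝ] ℝ :=
  mfderiv (𝓡 n) 𝓘(ℝ, ℝ) u x

variable [IsManifold (𝓡 n) ∞ M]

/-- The Legendre transformation `T_x M → T_x^* M`, `v ↦ g_v(v, ·)`. By linearity in the first slot
its value at `v = 0` is `0`. -/
def legendre (F : FinslerMetric n M) (x : M) (v : TangentSpace (𝓡 n) x) :
    TangentSpace (𝓡 n) x →L[ℝ] ℝ :=
  fundTensor (fun z : EuclideanSpace ℝ (Fin n) => F.toFun ⟨x, z⟩) v v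

/-- The gradient `∇u(x)`, the inverse image of `du_x` under the Legendre transformation. -/
def gradient (F : FinslerMetric n M) (u : M → ℝ) (x : M) : TangentSpace (𝓡 n) x :=
  Function.invFun (legendre F x) (differential u x)

end Manifold

/-! ### Local formulas

Functions of the coordinates `(x, y)` on `TM` are functions on `ℝⁿ × ℝⁿ`. The argument `L` is the
local expression `L(x, y)` of a Finsler metric. -/

section Coordinates

variable {n : ℕ}

/-- `∂f/∂xⁱ` -/
def pdx (f : EuclideanSpace ℝ (Fin n) × EuclideanSpace ℝ (Fin n) → ℝ) (i : Fin n)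
    (p : EuclideanSpace ℝ (Fin n) × EuclideanSpace ℝ (Fin n)) : ℝ :=
  fderiv ℝ f p (EuclideanSpace.single i 1, 0)

/-- `∂f/∂yⁱ` -/
def pdy (f : EuclideanSpace ℝ (Fin n) × EuclideanSpace ℝ (Fin n) → ℝ) (i : Fin n)
    (p : EuclideanSpace ℝ (Fin n) × EuclideanSpace ℝ (Fin n)) : ℝ :=
  fderiv ℝ f p (0, EuclideanSpace.single i 1)

variable (L : EuclideanSpace ℝ (Fin n) × EuclideanSpace ℝ (Fin n) → ℝ)

/-- `g_{ij} = ½ [L²]_{yⁱ yʲ}` -/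
def gLow (i j : Fin n) (p : EuclideanSpace ℝ (Fin n) × EuclideanSpace ℝ (Fin n)) : ℝ :=
  (1 / 2) * pdy (pdy (fun q => L q ^ 2) i) j p

/-- the inverse matrix `g^{ij}` -/
def gUp (i j : Fin n) (p : EuclideanSpace ℝ (Fin n) × EuclideanSpace ℝ (Fin n)) : ℝ :=
  ((Matrix.of fun a b => gLow L a b p)⁻¹ : Matrix (Fin n) (Fin n) ℝ) i j

/-- The Cartan tensor `C_{ijk} = ¼ [L²]_{yⁱ yʲ yᵏ}`. -/
def cartan (i j k : Fin n) (p : EuclideanSpace ℝ (Fin n) × EuclideanSpace ℝ (Fin n)) : ℝ :=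
  (1 / 4) * pdy (pdy (pdy (fun q => L q ^ 2) i) j) k p

/-- `C^r_{ij} = g^{rl} C_{lij}` -/
def cartanUp (r i j : Fin n) (p : EuclideanSpace ℝ (Fin n) × EuclideanSpace ℝ (Fin n)) : ℝ :=
  ∑ l, gUp L r l p * cartan L l i j p

/-- The spray coefficients `Gⁱ = ¼ g^{il} ([L²]_{xᵏ yˡ} yᵏ - [L²]_{xˡ})`. -/
def spray (i : Fin n) (p : EuclideanSpace ℝ (Fin n) × EuclideanSpace ℝ (Fin n)) : ℝ :=
  (1 / 4) * ∑ l, gUp L i l p *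
    ((∑ k, pdy (pdx (fun q => L q ^ 2) k) l p * p.2 k) - pdx (fun q => L q ^ 2) l p)

/-- The nonlinear connection `Nⁱ_j = ∂Gⁱ/∂yʲ`. -/
def nonlinConn (i j : Fin n) (p : EuclideanSpace ℝ (Fin n) × EuclideanSpace ℝ (Fin n)) : ℝ :=
  pdy (spray L i) j p

/-- The horizontal derivative `δf/δxʲ = ∂f/∂xʲ - N^m_j ∂f/∂y^m`. -/
def delta (f : EuclideanSpace ℝ (Fin n) × EuclideanSpace ℝ (Fin n) → ℝ) (j : Fin n)
    (p : EuclideanSpace ℝ (Fin n) × EuclideanSpace ℝ (Fin n)) : ℝ :=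
  pdx f j p - ∑ m, nonlinConn L m j p * pdy f m p

/-- The coefficients of the Chern connection,
`Γⁱ_{jk} = ½ g^{il} (δg_{lj}/δxᵏ + δg_{lk}/δxʲ - δg_{jk}/δxˡ)`; see `chern_unique`. -/
def chern (i j k : Fin n) (p : EuclideanSpace ℝ (Fin n) × EuclideanSpace ℝ (Fin n)) : ℝ :=
  (1 / 2) * ∑ l, gUp L i l p *
    (delta L (gLow L l j) k p + delta L (gLow L l k) j p - delta L (gLow L j k) l p)

/-- Horizontal covariant derivative `T_{i|j} = δT_i/δxʲ - Γᵏ_{ij} T_k` of a section `T_i dxⁱ` of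
`π^*T^*M` with respect to the Chern connection. -/
def covDeriv (T : Fin n → EuclideanSpace ℝ (Fin n) × EuclideanSpace ℝ (Fin n) → ℝ) (i j : Fin n)
    (p : EuclideanSpace ℝ (Fin n) × EuclideanSpace ℝ (Fin n)) : ℝ :=
  delta L (T i) j p - ∑ k, chern L k i j p * T k p

/-- `u_{|i|j}(x, y)` for a function `u = u(x)`, where `u_{|i} = δu/δxⁱ`. -/
def secondCov (u : EuclideanSpace ℝ (Fin n) → ℝ) (i j : Fin n)
    (p : EuclideanSpace ℝ (Fin n) × EuclideanSpace ℝ (Fin n)) : ℝ :=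
  covDeriv L (fun a => delta L (fun q => u q.1) a) i j p

/-- The complete lift `V̂ = Vⁱ ∂/∂xⁱ + yᵐ (∂Vⁱ/∂xᵐ) ∂/∂yⁱ` of a vector field `V = V(x)`. -/
def completeLift (V : EuclideanSpace ℝ (Fin n) → EuclideanSpace ℝ (Fin n))
    (p : EuclideanSpace ℝ (Fin n) × EuclideanSpace ℝ (Fin n)) :
    EuclideanSpace ℝ (Fin n) × EuclideanSpace ℝ (Fin n) :=
  (V p.1, fderiv ℝ V p.1 p.2)

/-- The Lie derivative `ℒ_{V̂} X = ρ[V̂, X]` of a section `X = Xⁱ(x, y) ∂_i` of `π^*TM`, with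
components `V̂(Xⁱ) - Xᵃ ∂Vⁱ/∂xᵃ`. (Only the part of the bracket that survives `ρ` is written, so
that `V` need not be more than once differentiable.) -/
def lieSection (V : EuclideanSpace ℝ (Fin n) → EuclideanSpace ℝ (Fin n))
    (X : EuclideanSpace ℝ (Fin n) × EuclideanSpace ℝ (Fin n) → EuclideanSpace ℝ (Fin n))
    (p : EuclideanSpace ℝ (Fin n) × EuclideanSpace ℝ (Fin n)) : EuclideanSpace ℝ (Fin n) :=
  fderiv ℝ X p (completeLift V p) - fderiv ℝ V p.1 (X p)

/-- `g(X, Y) = g_{ij}(x, y) Xⁱ Yʲ` for sections `X, Y` of `π^*TM`. -/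
def metric (X Y : EuclideanSpace ℝ (Fin n) × EuclideanSpace ℝ (Fin n) → EuclideanSpace ℝ (Fin n))
    (p : EuclideanSpace ℝ (Fin n) × EuclideanSpace ℝ (Fin n)) : ℝ :=
  ∑ i, ∑ j, gLow L i j p * X p i * Y p j

/-- The Lie derivative of the fundamental tensor,
`(ℒ_{V̂} g)(X, Y) = V̂(g(X, Y)) - g(ℒ_{V̂} X, Y) - g(X, ℒ_{V̂} Y)`. -/
def lieMetric (V : EuclideanSpace ℝ (Fin n) → EuclideanSpace ℝ (Fin n))
    (X Y : EuclideanSpace ℝ (Fin n) × EuclideanSpace ℝ (Fin n) → EuclideanSpace ℝ (Fin n))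
    (p : EuclideanSpace ℝ (Fin n) × EuclideanSpace ℝ (Fin n)) : ℝ :=
  fderiv ℝ (metric L X Y) p (completeLift V p)
    - metric L (lieSection V X) Y p - metric L X (lieSection V Y) p

/-- The components `ℒ_{V̂} g_{ij} = (ℒ_{V̂} g)(∂_i, ∂_j)`. -/
def lieG (V : EuclideanSpace ℝ (Fin n) → EuclideanSpace ℝ (Fin n)) (i j : Fin n)
    (p : EuclideanSpace ℝ (Fin n) × EuclideanSpace ℝ (Fin n)) : ℝ :=
  lieMetric L V (fun _ => EuclideanSpace.single i 1) (fun _ => EuclideanSpace.single j 1) p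

/-- Where `(g_{ij})` is symmetric and invertible, the Chern coefficients are the unique ones that
are torsion free and almost metric compatible, `δg_{ij}/δxᵏ = g_{lj} Γˡ_{ik} + g_{il} Γˡ_{jk}`. -/
theorem chern_unique (p : EuclideanSpace ℝ (Fin n) × EuclideanSpace ℝ (Fin n))
    (hs : ∀ i j, gLow L i j = gLow L j i)
    (hd : IsUnit (Matrix.of fun a b => gLow L a b p : Matrix (Fin n) (Fin n) ℝ).det)
    (A : Fin n → Fin n → Fin n → ℝ) :
    ((∀ i j k, A i j k = A i k j) ∧
      ∀ i j k, delta L (gLow L i j) k p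
        = ∑ l, gLow L l j p * A l i k + ∑ l, gLow L i l p * A l j k) ↔
      ∀ i j k, A i j k = chern L i j k p := by
  have h1 : ∀ f : Fin n → ℝ, ∀ i, ∑ l, gLow L i l p * ∑ m, gUp L l m p * f m = f i := by
    intro f i
    have h := congrFun (congrArg (fun B => Matrix.mulVec B f) (Matrix.mul_nonsing_inv _ hd)) i
    rw [← Matrix.mulVec_mulVec] at h
    simpa [Matrix.mulVec, dotProduct, gUp, Matrix.one_apply] using h
  have h2 : ∀ f : Fin n → ℝ, ∀ i, ∑ l, gUp L i l p * ∑ m, gLow L l m p * f m = f i := by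
    intro f i
    have h := congrFun (congrArg (fun B => Matrix.mulVec B f) (Matrix.nonsing_inv_mul _ hd)) i
    rw [← Matrix.mulVec_mulVec] at h
    simpa [Matrix.mulVec, dotProduct, gUp, Matrix.one_apply] using h
  constructor
  · rintro ⟨ha, hc⟩ i j k
    rw [chern, ← h2 (fun m => A m j k) i, Finset.mul_sum]
    refine Finset.sum_congr rfl fun l _ => ?_
    have e : ∀ a b c, ∑ m, gLow L m b p * A m a c = ∑ m, gLow L b m p * A m a c := fun a b c =>
      Finset.sum_congr rfl fun m _ => by rw [hs m b]
    have s : ∀ a b c, ∑ m, gLow L a m p * A m b c = ∑ m, gLow L a m p * A m c b := fun a b c =>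
      Finset.sum_congr rfl fun m _ => by rw [ha m b c]
    rw [hc l j k, hc l k j, hc j k l, e, e, e, s j l k, s k l j, s l k j, s j k l]
    ring
  · intro h
    have key : ∀ i j k, ∑ l, gLow L i l p * A l j k = (1 / 2) *
        (delta L (gLow L i j) k p + delta L (gLow L i k) j p - delta L (gLow L j k) i p) := by
      intro i j k
      rw [← h1 (fun m => delta L (gLow L m j) k p + delta L (gLow L m k) j p
        - delta L (gLow L j k) m p) i, Finset.mul_sum]
      refine Finset.sum_congr rfl fun l _ => ?_
      rw [h, chern]
      ring
    constructor
    · intro i j k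
      rw [h, h, chern, chern, hs j k]
      congr 1
      refine Finset.sum_congr rfl fun l _ => ?_
      ring
    · intro i j k
      have e : ∑ l, gLow L l j p * A l i k = ∑ l, gLow L j l p * A l i k :=
        Finset.sum_congr rfl fun m _ => by rw [hs m j]
      rw [e, key, key, hs j i, hs j k, hs i k]
      ring

end Coordinates

/-! ### Expressions in a chart `φ` of `M` -/

section Charts

variable {n : ℕ} {M : Type*} [TopologicalSpace M] [ChartedSpace (EuclideanSpace ℝ (Fin n)) M]
  [IsManifold (𝓡 n) ∞ M]

/-- The metric in the coordinates `(x, y)` on `TM` induced by `φ`: the value of `F` at the tangent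
vector `yⁱ ∂/∂xⁱ` at the point with coordinates `x`. -/
def localMetric (F : FinslerMetric n M) (φ : OpenPartialHomeomorph M (EuclideanSpace ℝ (Fin n)))
    (p : EuclideanSpace ℝ (Fin n) × EuclideanSpace ℝ (Fin n)) : ℝ :=
  F.toFun ⟨φ.symm p.1, mfderiv (𝓡 n) (𝓡 n) φ.symm p.1 p.2⟩

/-- The components `(∇¹u, …, ∇ⁿu)` of the gradient as functions of the coordinates. -/
def localGradient (F : FinslerMetric n M) (u : M → ℝ)
    (φ : OpenPartialHomeomorph M (EuclideanSpace ℝ (Fin n))) (a : EuclideanSpace ℝ (Fin n)) :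
    EuclideanSpace ℝ (Fin n) :=
  mfderiv (𝓡 n) (𝓡 n) φ (φ.symm a) (gradient F u (φ.symm a))

/-- The coordinates `(x, ∇u)` of the tangent vector `∇u(x)`. -/
def gradPoint (F : FinslerMetric n M) (u : M → ℝ)
    (φ : OpenPartialHomeomorph M (EuclideanSpace ℝ (Fin n))) (x : M) :
    EuclideanSpace ℝ (Fin n) × EuclideanSpace ℝ (Fin n) :=
  (φ x, localGradient F u φ (φ x))

/-- The Hessian matrix `Hess(u) = (u_{|i|j}(x, ∇u))`. -/
def hess (F : FinslerMetric n M) (u : M → ℝ)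
    (φ : OpenPartialHomeomorph M (EuclideanSpace ℝ (Fin n))) (x : M) :
    Matrix (Fin n) (Fin n) ℝ :=
  Matrix.of fun i j => secondCov (localMetric F φ) (u ∘ φ.symm) i j (gradPoint F u φ x)

/-- The matrix `ℒ_{V̂} g (x, ∇u)` with `V = ∇u`. -/
def lieGradMatrix (F : FinslerMetric n M) (u : M → ℝ)
    (φ : OpenPartialHomeomorph M (EuclideanSpace ℝ (Fin n))) (x : M) :
    Matrix (Fin n) (Fin n) ℝ :=
  Matrix.of fun i j => lieG (localMetric F φ) (localGradient F u φ) i j (gradPoint F u φ x)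

/-- The matrix `((∇ᵐu) u_{|r|m}(x, ∇u) C^r_{ij}(x, ∇u))`. -/
def cartanGradMatrix (F : FinslerMetric n M) (u : M → ℝ)
    (φ : OpenPartialHomeomorph M (EuclideanSpace ℝ (Fin n))) (x : M) :
    Matrix (Fin n) (Fin n) ℝ :=
  Matrix.of fun i j => ∑ m, ∑ r, localGradient F u φ (φ x) m *
    secondCov (localMetric F φ) (u ∘ φ.symm) r m (gradPoint F u φ x) *
    cartanUp (localMetric F φ) r i j (gradPoint F u φ x)

end Charts

end Finsler

end

noncomputable section

namespace Finsler

open Set Filter Topology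

/-! On each tangent space the Legendre transformation is the differential of ½F², by Euler's
identity for degree one. Positivity of `fundTensor` makes it monotone along segments avoiding the
origin, hence injective; maximising ξ/F on the unit sphere gives surjectivity. Its fibre derivative
is g, so the inverse function theorem on TM makes ∇u of class C¹ where du ≠ 0.

For the Hessian, put V = ∇u and evaluate at y = V(x). Duality says ∂ᵢu = ½[L²]_{yⁱ}(x, V(x));
differentiating, uᵢⱼ = ½[L²]_{xʲyⁱ} + gᵢₘ ∂ⱼVᵐ. By Euler's identity the Chern term Γᵏᵢⱼ ∂ₖu reduces
to mixed derivatives of L² and yˡ δgᵢⱼ/δxˡ (`sum_chern`). Averaging the formulas for uᵢⱼ and uⱼᵢ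
cancels the mixed derivatives, and yˡNᵐₗ = 2Gᵐ turns yˡ δ/δxˡ into yˡ ∂/∂xˡ − 2Gᵐ ∂/∂yᵐ. The result
differs from ½ℒg by ½ Zᵏ ∂gᵢⱼ/∂yᵏ with Zᵏ = Vᵐ∂ₘVᵏ + 2Gᵏ. Since Vᵐ u_{|r|m} = gᵣₖZᵏ and ∂gᵢⱼ/∂yᵏ =
2Cᵢⱼₖ, this is the Cartan term (`IsLocalFinsler.secondCov_eq_lieG`). -/

/-- Euler's identity for positively homogeneous maps. -/
theorem fderiv_apply_self_of_homogeneous {E G : Type*} [NormedAddCommGroup E] [NormedSpace ℝ E]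
    [NormedAddCommGroup G] [NormedSpace ℝ G] {g : E → G} {k : ℤ} {v : E}
    (hg : ∀ c : ℝ, 0 < c → g (c • v) = c ^ k • g v) (hd : DifferentiableAt ℝ g v) :
    fderiv ℝ g v v = (k : ℝ) • g v := by
  have h1 : HasDerivAt (fun c : ℝ => g (c • v)) (fderiv ℝ g v v) 1 := by
    have hl : HasDerivAt (fun c : ℝ => c • v) v 1 := by
      simpa using (hasDerivAt_id (1 : ℝ)).smul_const v
    have hd' : HasFDerivAt g (fderiv ℝ g v) ((1 : ℝ) • v) := by
      simpa using hd.hasFDerivAt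
    exact hd'.comp_hasDerivAt 1 hl
  have h2 : HasDerivAt (fun c : ℝ => c ^ k • g v) ((k : ℝ) • g v) 1 := by
    simpa using (hasDerivAt_zpow k (1 : ℝ) (Or.inl one_ne_zero)).smul_const (g v)
  refine h1.unique (h2.congr_of_eventuallyEq ?_)
  filter_upwards [lt_mem_nhds (zero_lt_one' ℝ)] with c hc using hg c hc

/-! ### Minkowski functions and their Legendre transformation -/

/-- Minkowski functions, the restrictions of Finsler metrics to tangent spaces. -/
structure IsMinkowski {E : Type*} [NormedAddCommGroup E] [NormedSpace ℝ E] (f : E → ℝ) :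
    Prop where
  nonneg : ∀ v, 0 ≤ f v
  smooth : ContDiffOn ℝ ∞ f {0}ᶜ
  homogeneous : ∀ (v : E) (c : ℝ), 0 < c → f (c • v) = c * f v
  posDef : ∀ v w : E, v ≠ 0 → w ≠ 0 → 0 < fundTensor f v w w

namespace IsMinkowski

variable {E : Type*} [NormedAddCommGroup E] [NormedSpace ℝ E] {f : E → ℝ}

theorem contDiffAt (hf : IsMinkowski f) {v : E} (hv : v ≠ 0) : ContDiffAt ℝ ∞ f v :=
  hf.smooth.contDiffAt (isOpen_compl_singleton.mem_nhds hv)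

theorem contDiffAt_sq (hf : IsMinkowski f) {v : E} (hv : v ≠ 0) :
    ContDiffAt ℝ ∞ (fun w => f w ^ 2) v :=
  (hf.contDiffAt hv).pow 2

theorem contDiffAt_fderiv_sq (hf : IsMinkowski f) {v : E} (hv : v ≠ 0) :
    ContDiffAt ℝ ∞ (fderiv ℝ (fun w => f w ^ 2)) v :=
  (hf.contDiffAt_sq hv).fderiv_right (by simp)

theorem fderiv_sq_smul (hf : IsMinkowski f) {v : E} (hv : v ≠ 0) {c : ℝ} (hc : 0 < c) :
    fderiv ℝ (fun w => f w ^ 2) (c • v) = c • fderiv ℝ (fun w => f w ^ 2) v := by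
  have h1 : (fun w => f (c • w) ^ 2) = fun w => c ^ 2 • f w ^ 2 := by
    funext w; rw [hf.homogeneous w c hc, smul_eq_mul]; ring
  have h2 := fderiv_comp_smul (𝕜 := ℝ) (f := fun w => f w ^ 2) (x := v) (c := c)
  rw [h1, fderiv_fun_const_smul ((hf.contDiffAt_sq hv).differentiableAt (by simp))] at h2
  -- The chain rule contributes one factor c against the c² of homogeneity; it is cancelled here.
  have h3 := congrArg (fun A => c⁻¹ • A) h2
  simp only [smul_smul] at h3
  rw [inv_mul_cancel₀ hc.ne', one_smul] at h3
  rw [← h3]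
  congr 1
  field_simp

/-- Euler's identity for the degree-one map D(f²). It makes the Legendre transformation a
first-order object, the differential of ½f². -/
theorem fundTensor_self (hf : IsMinkowski f) {v : E} (hv : v ≠ 0) :
    fundTensor f v v = (1 / 2 : ℝ) • fderiv ℝ (fun w => f w ^ 2) v := by
  have := fderiv_apply_self_of_homogeneous (g := fderiv ℝ (fun w => f w ^ 2)) (k := 1) (v := v)
    (fun c hc => by rw [hf.fderiv_sq_smul hv hc, zpow_one])
    ((hf.contDiffAt_fderiv_sq hv).differentiableAt (by simp))
  simp [fundTensor, this]

theorem fundTensor_self_self (hf : IsMinkowski f) {v : E} (hv : v ≠ 0) :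
    fundTensor f v v v = f v ^ 2 := by
  have := fderiv_apply_self_of_homogeneous (g := fun w => f w ^ 2) (k := 2) (v := v)
    (fun c hc => by rw [hf.homogeneous v c hc, smul_eq_mul, mul_pow]; norm_cast)
    ((hf.contDiffAt_sq hv).differentiableAt (by simp))
  simp [hf.fundTensor_self hv, this]

theorem pos (hf : IsMinkowski f) {v : E} (hv : v ≠ 0) : 0 < f v := by
  have h := hf.posDef v v hv hv
  rw [hf.fundTensor_self_self hv] at h
  exact lt_of_le_of_ne (hf.nonneg v) fun h0 => by simp [← h0] at h

theorem legendre_eq_zero_iff (hf : IsMinkowski f) {v : E} : fundTensor f v v = 0 ↔ v = 0 := by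
  refine ⟨fun h => ?_, fun h => by simp [h]⟩
  by_contra hv
  have := hf.posDef v v hv hv
  simp [h] at this

theorem legendre_smul (hf : IsMinkowski f) (v : E) {c : ℝ} (hc : 0 < c) :
    fundTensor f (c • v) (c • v) = c • fundTensor f v v := by
  by_cases hv : v = 0
  · simp [hv]
  · rw [hf.fundTensor_self hv, hf.fundTensor_self (smul_ne_zero hc.ne' hv),
      hf.fderiv_sq_smul hv hc, smul_comm]

/-- Along a segment that avoids the origin the Legendre transformation is strictly monotone. -/
theorem legendre_lt_of_segment (hf : IsMinkowski f) {v w : E} (hvw : v ≠ w)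
    (hs : ∀ t ∈ Icc (0 : ℝ) 1, v + t • (w - v) ≠ 0) :
    fundTensor f v v (w - v) < fundTensor f w w (w - v) := by
  set D := fderiv ℝ (fun z => f z ^ 2) with hD
  have hder : ∀ t ∈ Icc (0 : ℝ) 1, HasDerivAt (fun t : ℝ => D (v + t • (w - v)) (w - v))
      (fderiv ℝ D (v + t • (w - v)) (w - v) (w - v)) t := by
    intro t ht
    have hl : HasDerivAt (fun t : ℝ => v + t • (w - v)) (w - v) t := by
      simpa using ((hasDerivAt_id t).smul_const (w - v)).const_add v
    have h1 := ((hf.contDiffAt_fderiv_sq (hs t ht)).differentiableAt (by simp)).hasFDerivAt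
    have h2 : HasDerivAt (fun t : ℝ => D (v + t • (w - v)))
        (fderiv ℝ D (v + t • (w - v)) (w - v)) t := h1.comp_hasDerivAt t hl
    have h3 := (ContinuousLinearMap.apply ℝ ℝ (w - v)).hasFDerivAt.comp_hasDerivAt t h2
    exact h3
  -- The derivative along the segment is twice the fundamental tensor on the nonzero direction w −
  -- v.
  have hmono : StrictMonoOn (fun t : ℝ => D (v + t • (w - v)) (w - v)) (Icc 0 1) := by
    refine strictMonoOn_of_deriv_pos (convex_Icc 0 1)
      (fun t ht => (hder t ht).continuousAt.continuousWithinAt) fun t ht => ?_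
    have ht' := interior_subset ht
    rw [(hder t ht').deriv]
    have := hf.posDef _ _ (hs t ht') (sub_ne_zero.2 hvw.symm)
    simp only [fundTensor, smul_apply, smul_eq_mul] at this
    linarith
  have h := hmono (left_mem_Icc.2 zero_le_one) (right_mem_Icc.2 zero_le_one) zero_lt_one
  have hv : v ≠ 0 := by simpa using hs 0 (by simp)
  have hw : w ≠ 0 := by simpa using hs 1 (by simp)
  simp only [zero_smul, add_zero, one_smul, add_sub_cancel] at h
  rw [hf.fundTensor_self hv, hf.fundTensor_self hw]
  simp only [smul_apply, smul_eq_mul]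
  linarith

theorem legendre_injective (hf : IsMinkowski f) :
    Function.Injective fun v => fundTensor f v v := by
  intro v w h
  simp only at h
  by_contra hvw
  by_cases hv : v = 0
  · rw [hv] at h
    simp only [map_zero] at h
    exact hvw (hv.trans (hf.legendre_eq_zero_iff.1 h.symm).symm)
  by_cases hw : w = 0
  · rw [hw] at h
    simp only [map_zero] at h
    exact hv (hf.legendre_eq_zero_iff.1 h)
  by_cases hs : ∀ t ∈ Icc (0 : ℝ) 1, v + t • (w - v) ≠ 0
  · exact (hf.legendre_lt_of_segment hvw hs).ne (by rw [h])
  · push Not at hs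
    obtain ⟨t, ht, h0⟩ := hs
    -- Here v and w lie on opposite rays. The common covector is positive on both, yet (1 − t)v + tw
    -- = 0.
    have h1 := congrArg (fundTensor f v v) h0
    have h2 := hf.posDef v v hv hv
    have h3 := hf.posDef w w hw hw
    rw [← h] at h3
    simp only [map_add, map_smul, map_sub, map_zero, smul_eq_mul] at h1
    rcases ht.2.lt_or_eq with h4 | rfl
    · nlinarith [ht.1, mul_pos (sub_pos.2 h4) h2, mul_nonneg ht.1 h3.le]
    · linarith

/-- At a maximum v of the degree-zero quotient ξ/f one has ξ = m·df_v with m the maximal value. The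
Legendre image of v is f(v)·df_v, so rescaling v by m/f(v) hits ξ. -/
theorem legendre_surjective [FiniteDimensional ℝ E] (hf : IsMinkowski f) :
    Function.Surjective fun v => fundTensor f v v := by
  intro ξ
  by_cases hξ : ξ = 0
  · exact ⟨0, by simp [hξ]⟩
  -- Such a w makes the sphere nonempty and the maximum positive, hence the final rescaling
  -- admissible.
  obtain ⟨w, hw⟩ : ∃ w, 0 < ξ w := by
    by_contra! h
    refine hξ (ContinuousLinearMap.ext fun w => le_antisymm (h w) ?_)
    have := h (-w)
    simp only [map_neg, zero_apply] at this ⊢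
    linarith
  have hw0 : w ≠ 0 := fun h => by simp [h] at hw
  have hne : ∀ v ∈ Metric.sphere (0 : E) 1, v ≠ 0 := fun v hv => ne_zero_of_mem_unit_sphere ⟨v, hv⟩
  have hnorm : ∀ v : E, v ≠ 0 → ‖v‖⁻¹ • v ∈ Metric.sphere (0 : E) 1 := fun v hv => by
    simp [norm_smul, hv]
  have hcont : ContinuousOn (fun v => ξ v / f v) (Metric.sphere (0 : E) 1) := fun v hv =>
    (ξ.continuous.continuousAt.div (hf.contDiffAt (hne v hv)).continuousAt
      (hf.pos (hne v hv)).ne').continuousWithinAt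
  obtain ⟨v, hv, hmax⟩ := (isCompact_sphere (0 : E) 1).exists_isMaxOn ⟨_, hnorm w hw0⟩ hcont
  have hv0 := hne v hv
  have hmax' : ∀ z, z ≠ 0 → ξ z / f z ≤ ξ v / f v := fun z hz => by
    have hz' : 0 < ‖z‖⁻¹ := inv_pos.2 (norm_pos_iff.2 hz)
    have h := hmax (hnorm z hz)
    simp only [mem_ofPred_eq, hf.homogeneous z _ hz', map_smul, smul_eq_mul] at h
    rwa [mul_div_mul_left _ _ hz'.ne'] at h
  set m := ξ v / f v with hm
  have hm0 : 0 < m := (div_pos hw (hf.pos hw0)).trans_le (hmax' w hw0)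
  -- Subtracting m·f avoids differentiating a quotient: this function is at most 0 off the origin
  -- and vanishes at v.
  have hloc : IsLocalMax (fun z => ξ z - m * f z) v := by
    filter_upwards [isOpen_compl_singleton.mem_nhds hv0] with z hz
    have h1 := (div_le_iff₀ (hf.pos hz)).1 (hmax' z hz)
    have h2 : ξ v = m * f v := by rw [hm, div_mul_cancel₀ _ (hf.pos hv0).ne']
    linarith
  have hfd := ((hf.contDiffAt hv0).differentiableAt (by simp)).hasFDerivAt
  have hcrit := hloc.hasFDerivAt_eq_zero (ξ.hasFDerivAt.sub (hfd.const_mul m))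
  have hsq : fderiv ℝ (fun w => f w ^ 2) v = (2 * f v) • fderiv ℝ f v := by
    rw [(hfd.pow 2).fderiv]; simp
  have hfv := hf.pos hv0
  refine ⟨(m / f v) • v, ?_⟩
  simp only
  rw [hf.legendre_smul v (div_pos hm0 hfv), hf.fundTensor_self hv0, hsq, sub_eq_zero.1 hcrit,
    smul_smul, smul_smul]
  congr 1
  field_simp

theorem legendre_bijective [FiniteDimensional ℝ E] (hf : IsMinkowski f) :
    Function.Bijective fun v => fundTensor f v v :=
  ⟨hf.legendre_injective, hf.legendre_surjective⟩

end IsMinkowski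

/-! ### Calculus in the coordinates `(x, y)` -/

section Calculus

variable {n : ℕ} {f g : EuclideanSpace ℝ (Fin n) × EuclideanSpace ℝ (Fin n) → ℝ}
  {Ω : Set (EuclideanSpace ℝ (Fin n) × EuclideanSpace ℝ (Fin n))}
  {U : Set (EuclideanSpace ℝ (Fin n))}
  {p : EuclideanSpace ℝ (Fin n) × EuclideanSpace ℝ (Fin n)}

theorem sum_smul_single (v : EuclideanSpace ℝ (Fin n)) :
    ∑ i, v i • EuclideanSpace.single i (1 : ℝ) = v := by
  simpa using (EuclideanSpace.basisFun (Fin n) ℝ).sum_repr v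

theorem map_eq_sum_single {G : Type*} [NormedAddCommGroup G] [NormedSpace ℝ G]
    (A : EuclideanSpace ℝ (Fin n) →L[ℝ] G) (v : EuclideanSpace ℝ (Fin n)) :
    A v = ∑ i, v i • A (EuclideanSpace.single i 1) := by
  conv_lhs => rw [← sum_smul_single v]
  simp only [map_sum, map_smul]

theorem fderiv_snd_eq_sum (f : EuclideanSpace ℝ (Fin n) × EuclideanSpace ℝ (Fin n) → ℝ)
    (p : EuclideanSpace ℝ (Fin n) × EuclideanSpace ℝ (Fin n)) (w : EuclideanSpace ℝ (Fin n)) :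
    fderiv ℝ f p (0, w) = ∑ i, w i * pdy f i p := by
  simpa [pdy] using map_eq_sum_single
    ((fderiv ℝ f p).comp (ContinuousLinearMap.inr ℝ (EuclideanSpace ℝ (Fin n)) _)) w

theorem fderiv_fst_eq_sum (f : EuclideanSpace ℝ (Fin n) × EuclideanSpace ℝ (Fin n) → ℝ)
    (p : EuclideanSpace ℝ (Fin n) × EuclideanSpace ℝ (Fin n)) (v : EuclideanSpace ℝ (Fin n)) :
    fderiv ℝ f p (v, 0) = ∑ i, v i * pdx f i p := by
  simpa [pdx] using map_eq_sum_single
    ((fderiv ℝ f p).comp (ContinuousLinearMap.inl ℝ _ (EuclideanSpace ℝ (Fin n)))) v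

theorem fderiv_eq_sum (f : EuclideanSpace ℝ (Fin n) × EuclideanSpace ℝ (Fin n) → ℝ)
    (p : EuclideanSpace ℝ (Fin n) × EuclideanSpace ℝ (Fin n)) (v w : EuclideanSpace ℝ (Fin n)) :
    fderiv ℝ f p (v, w) = ∑ i, v i * pdx f i p + ∑ i, w i * pdy f i p := by
  rw [← fderiv_fst_eq_sum, ← fderiv_snd_eq_sum, ← map_add]
  simp

theorem contDiffOn_pdx (hΩ : IsOpen Ω) (hf : ContDiffOn ℝ ∞ f Ω) (i : Fin n) :
    ContDiffOn ℝ ∞ (pdx f i) Ω :=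
  (hf.fderiv_of_isOpen hΩ (by simp)).clm_apply contDiffOn_const

theorem contDiffOn_pdy (hΩ : IsOpen Ω) (hf : ContDiffOn ℝ ∞ f Ω) (i : Fin n) :
    ContDiffOn ℝ ∞ (pdy f i) Ω :=
  (hf.fderiv_of_isOpen hΩ (by simp)).clm_apply contDiffOn_const

/-- Only C² is required, because it is also applied to the chart expression of u. -/
theorem fderiv_fderiv_apply_comm {E : Type*} [NormedAddCommGroup E] [NormedSpace ℝ E]
    {h : E → ℝ} {q : E} (hh : ContDiffAt ℝ 2 h q) (v w : E) :
    fderiv ℝ (fun z => fderiv ℝ h z v) q w = fderiv ℝ (fun z => fderiv ℝ h z w) q v := by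
  have hd : DifferentiableAt ℝ (fderiv ℝ h) q :=
    (hh.fderiv_right (m := 1) (by norm_num)).differentiableAt (by simp)
  have key : ∀ v w, fderiv ℝ (fun z => fderiv ℝ h z v) q w = fderiv ℝ (fderiv ℝ h) q w v := by
    intro v w
    rw [fderiv_clm_apply hd (differentiableAt_const v)]
    simp
  rw [key, key]
  exact (hh.isSymmSndFDerivAt (by simp)) w v

theorem pdx_congr (h : f =ᶠ[𝓝 p] g) (i : Fin n) : pdx f i p = pdx g i p := by
  rw [pdx, pdx, h.fderiv_eq]

theorem pdy_congr (h : f =ᶠ[𝓝 p] g) (i : Fin n) : pdy f i p = pdy g i p := by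
  rw [pdy, pdy, h.fderiv_eq]

theorem pdx_const_mul (hf : DifferentiableAt ℝ f p) (c : ℝ) (i : Fin n) :
    pdx (fun q => c * f q) i p = c * pdx f i p := by
  rw [pdx, fderiv_const_mul hf]; rfl

theorem pdy_const_mul (hf : DifferentiableAt ℝ f p) (c : ℝ) (i : Fin n) :
    pdy (fun q => c * f q) i p = c * pdy f i p := by
  rw [pdy, fderiv_const_mul hf]; rfl

/-- Positive homogeneity of degree `k` in the fibre variable `y` over `U`. -/
def FibreHomogeneous (U : Set (EuclideanSpace ℝ (Fin n))) (k : ℤ)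
    (f : EuclideanSpace ℝ (Fin n) × EuclideanSpace ℝ (Fin n) → ℝ) : Prop :=
  ∀ a ∈ U, ∀ y : EuclideanSpace ℝ (Fin n), y ≠ 0 → ∀ c : ℝ, 0 < c →
    f (a, c • y) = c ^ k * f (a, y)

theorem isOpen_prod_compl_zero (hU : IsOpen U) :
    IsOpen (U ×ˢ ({0}ᶜ : Set (EuclideanSpace ℝ (Fin n)))) :=
  hU.prod isOpen_compl_singleton

theorem differentiableAt_of_contDiffOn (hΩ : IsOpen Ω) (hf : ContDiffOn ℝ ∞ f Ω) (hp : p ∈ Ω) :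
    DifferentiableAt ℝ f p :=
  (hf.contDiffAt (hΩ.mem_nhds hp)).differentiableAt (by simp)

/-- Chain rule for (x, y) ↦ (x, cy). Taking w = 0 shows that ∂/∂x keeps the degree, taking v = 0
that ∂/∂y lowers it by one. -/
theorem FibreHomogeneous.fderiv_smul {k : ℤ} (hf : FibreHomogeneous U k f) (hU : IsOpen U)
    (hs : ContDiffOn ℝ ∞ f (U ×ˢ {0}ᶜ)) {a y : EuclideanSpace ℝ (Fin n)} (ha : a ∈ U) (hy : y ≠ 0)
    {c : ℝ} (hc : 0 < c) (v w : EuclideanSpace ℝ (Fin n)) :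
    fderiv ℝ f (a, c • y) (v, c • w) = c ^ k * fderiv ℝ f (a, y) (v, w) := by
  have hΩ := isOpen_prod_compl_zero hU
  let S : (EuclideanSpace ℝ (Fin n) × EuclideanSpace ℝ (Fin n)) →L[ℝ]
      EuclideanSpace ℝ (Fin n) × EuclideanSpace ℝ (Fin n) :=
    (ContinuousLinearMap.id ℝ _).prodMap (c • ContinuousLinearMap.id ℝ _)
  have hd1 : DifferentiableAt ℝ f (S (a, y)) :=
    differentiableAt_of_contDiffOn hΩ hs ⟨ha, smul_ne_zero hc.ne' hy⟩
  have hd0 : DifferentiableAt ℝ f (a, y) := differentiableAt_of_contDiffOn hΩ hs ⟨ha, hy⟩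
  have h1 : HasFDerivAt (fun q => f (S q)) ((fderiv ℝ f (S (a, y))).comp S) (a, y) :=
    hd1.hasFDerivAt.comp (a, y) S.hasFDerivAt
  have h2 : HasFDerivAt (fun q => f (S q)) (c ^ k • fderiv ℝ f (a, y)) (a, y) := by
    refine (hd0.hasFDerivAt.const_mul (c ^ k)).congr_of_eventuallyEq ?_
    filter_upwards [hΩ.mem_nhds (show (a, y) ∈ U ×ˢ {0}ᶜ from ⟨ha, hy⟩)] with q hq
    exact hf q.1 hq.1 q.2 hq.2 c hc
  have h3 := congrArg (fun A => A (v, w)) (h1.unique h2)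
  simpa [S] using h3

theorem FibreHomogeneous.pdx {k : ℤ} (hf : FibreHomogeneous U k f) (hU : IsOpen U)
    (hs : ContDiffOn ℝ ∞ f (U ×ˢ {0}ᶜ)) (i : Fin n) : FibreHomogeneous U k (pdx f i) :=
  fun a ha y hy c hc => by
    simpa [Finsler.pdx] using hf.fderiv_smul hU hs ha hy hc (EuclideanSpace.single i 1) 0

theorem FibreHomogeneous.pdy {k : ℤ} (hf : FibreHomogeneous U k f) (hU : IsOpen U)
    (hs : ContDiffOn ℝ ∞ f (U ×ˢ {0}ᶜ)) (i : Fin n) :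
    FibreHomogeneous U (k - 1) (pdy f i) :=
  fun a ha y hy c hc => by
    have h := hf.fderiv_smul hU hs ha hy hc 0 (EuclideanSpace.single i 1)
    have h2 : ((0 : EuclideanSpace ℝ (Fin n)), c • EuclideanSpace.single i (1 : ℝ))
        = c • ((0 : EuclideanSpace ℝ (Fin n)), EuclideanSpace.single i (1 : ℝ)) := by simp
    rw [h2, map_smul, smul_eq_mul] at h
    rw [Finsler.pdy, Finsler.pdy, zpow_sub_one₀ hc.ne', mul_right_comm, ← h]
    field_simp

theorem FibreHomogeneous.sum_mul_pdy {k : ℤ} (hf : FibreHomogeneous U k f)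
    (hp1 : p.1 ∈ U) (hp2 : p.2 ≠ 0) (hd : DifferentiableAt ℝ f p) :
    ∑ j, p.2 j * Finsler.pdy f j p = k * f p := by
  rw [← fderiv_snd_eq_sum]
  have h1 : HasFDerivAt (fun y => f (p.1, y))
      ((fderiv ℝ f p).comp (ContinuousLinearMap.inr ℝ _ _)) p.2 :=
    hd.hasFDerivAt.comp p.2 (hasFDerivAt_prodMk_right p.1 p.2)
  have h2 := fderiv_apply_self_of_homogeneous (g := fun y => f (p.1, y)) (k := k) (v := p.2)
    (fun c hc => by simpa using hf p.1 hp1 p.2 hp2 c hc) h1.differentiableAt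
  rw [h1.fderiv] at h2
  simpa using h2

theorem pdx_comp_fst {h : EuclideanSpace ℝ (Fin n) → ℝ} (hd : DifferentiableAt ℝ h p.1)
    (i : Fin n) :
    pdx (fun q => h q.1) i p = fderiv ℝ h p.1 (EuclideanSpace.single i 1) := by
  have h1 : HasFDerivAt (fun q : EuclideanSpace ℝ (Fin n) × EuclideanSpace ℝ (Fin n) => h q.1)
      ((fderiv ℝ h p.1).comp (ContinuousLinearMap.fst ℝ _ _)) p :=
    hd.hasFDerivAt.comp p hasFDerivAt_fst
  rw [pdx, h1.fderiv]; rfl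

theorem pdy_comp_fst {h : EuclideanSpace ℝ (Fin n) → ℝ} (hd : DifferentiableAt ℝ h p.1)
    (i : Fin n) : pdy (fun q => h q.1) i p = 0 := by
  have h1 : HasFDerivAt (fun q : EuclideanSpace ℝ (Fin n) × EuclideanSpace ℝ (Fin n) => h q.1)
      ((fderiv ℝ h p.1).comp (ContinuousLinearMap.fst ℝ _ _)) p :=
    hd.hasFDerivAt.comp p hasFDerivAt_fst
  rw [pdy, h1.fderiv]; simp

/-! ### Coordinate formulas for the Hessian and the Lie derivative -/

theorem delta_comp_fst (L : EuclideanSpace ℝ (Fin n) × EuclideanSpace ℝ (Fin n) → ℝ)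
    {h : EuclideanSpace ℝ (Fin n) → ℝ} (hd : DifferentiableAt ℝ h p.1) (i : Fin n) :
    delta L (fun q => h q.1) i p = fderiv ℝ h p.1 (EuclideanSpace.single i 1) := by
  simp [delta, pdx_comp_fst hd, pdy_comp_fst hd]

theorem delta_congr (L : EuclideanSpace ℝ (Fin n) × EuclideanSpace ℝ (Fin n) → ℝ)
    (h : f =ᶠ[𝓝 p] g) (i : Fin n) : delta L f i p = delta L g i p := by
  simp only [delta, pdx_congr h, pdy_congr h]

theorem secondCov_eq (L : EuclideanSpace ℝ (Fin n) × EuclideanSpace ℝ (Fin n) → ℝ)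
    {w : EuclideanSpace ℝ (Fin n) → ℝ} (hw : ContDiffAt ℝ 2 w p.1) (i j : Fin n) :
    secondCov L w i j p
      = fderiv ℝ (fun a => fderiv ℝ w a (EuclideanSpace.single i 1)) p.1 (EuclideanSpace.single j 1)
        - ∑ k, chern L k i j p * fderiv ℝ w p.1 (EuclideanSpace.single k 1) := by
  have hev : ∀ᶠ q in 𝓝 p, DifferentiableAt ℝ w q.1 :=
    continuousAt_fst.eventually ((hw.eventually (by simp)).mono
      fun a ha => ha.differentiableAt (by simp))
  have hd : DifferentiableAt ℝ (fun a => fderiv ℝ w a (EuclideanSpace.single i 1)) p.1 :=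
    ((hw.fderiv_right (m := 1) (by norm_num)).differentiableAt (by simp)).clm_apply
      (differentiableAt_const _)
  have hg : delta L (fun q => w q.1) i =ᶠ[𝓝 p]
      -- Equality near p, not only at p, is needed since this function is differentiated again.
      fun q => fderiv ℝ w q.1 (EuclideanSpace.single i 1) :=
    hev.mono fun q hq => delta_comp_fst L hq i
  simp only [secondCov, covDeriv]
  rw [delta_congr L hg, delta_comp_fst L hd]
  congr 1
  exact Finset.sum_congr rfl fun k _ => by rw [delta_comp_fst L (hw.differentiableAt (by simp))]

/-- A constant section eᵢ has Lie derivative −DV(eᵢ), which turns the two subtracted terms into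
sums. -/
theorem lieG_eq (L : EuclideanSpace ℝ (Fin n) × EuclideanSpace ℝ (Fin n) → ℝ)
    (V : EuclideanSpace ℝ (Fin n) → EuclideanSpace ℝ (Fin n)) (i j : Fin n) :
    lieG L V i j p = ∑ k, V p.1 k * pdx (gLow L i j) k p
      + ∑ k, fderiv ℝ V p.1 p.2 k * pdy (gLow L i j) k p
      + ∑ a, fderiv ℝ V p.1 (EuclideanSpace.single i 1) a * gLow L a j p
      + ∑ a, fderiv ℝ V p.1 (EuclideanSpace.single j 1) a * gLow L i a p := by
  have hm : metric L (fun _ => EuclideanSpace.single i 1) (fun _ => EuclideanSpace.single j 1)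
      = gLow L i j := by
    funext q
    simp [metric]
  simp only [lieG, lieMetric, hm, completeLift, fderiv_eq_sum]
  simp [metric, lieSection, mul_comm]

theorem differentiableAt_det {E : Type*} [NormedAddCommGroup E] [NormedSpace ℝ E] {m : ℕ}
    {A : E → Matrix (Fin m) (Fin m) ℝ} {q : E}
    (hA : ∀ i j, DifferentiableAt ℝ (fun z => A z i j) q) :
    DifferentiableAt ℝ (fun z => (A z).det) q := by
  simp only [Matrix.det_apply]
  refine DifferentiableAt.fun_sum fun σ _ => ?_
  have h : HasFDerivAt (fun z => ∏ i, A z (σ i) i) _ q :=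
    HasFDerivAt.finsetProd fun i _ => (hA (σ i) i).hasFDerivAt
  exact h.differentiableAt.const_smul _

/-- Cramer's rule: each entry of the inverse is a quotient of determinants. -/
theorem differentiableAt_inv_apply {E : Type*} [NormedAddCommGroup E] [NormedSpace ℝ E] {m : ℕ}
    {A : E → Matrix (Fin m) (Fin m) ℝ} {q : E}
    (hA : ∀ i j, DifferentiableAt ℝ (fun z => A z i j) q) (h0 : (A q).det ≠ 0) (i j : Fin m) :
    DifferentiableAt ℝ (fun z => (A z)⁻¹ i j) q := by
  simp only [Matrix.inv_def, Matrix.smul_apply, Matrix.adjugate_apply, Ring.inverse_eq_inv',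
    smul_eq_mul]
  refine ((differentiableAt_det hA).inv h0).mul (differentiableAt_det fun k l => ?_)
  simp only [Matrix.updateRow_apply]
  split_ifs
  · exact differentiableAt_const _
  · exact hA k l

end Calculus

/-! ### Local expressions of Finsler metrics -/

/-- Local expressions `L(x, y)` of Finsler metrics over an open set `U` of coordinates `x`. -/
structure IsLocalFinsler {n : ℕ} (U : Set (EuclideanSpace ℝ (Fin n)))
    (L : EuclideanSpace ℝ (Fin n) × EuclideanSpace ℝ (Fin n) → ℝ) : Prop where
  isOpen : IsOpen U
  smooth : ContDiffOn ℝ ∞ L (U ×ˢ {0}ᶜ)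
  minkowski : ∀ a ∈ U, IsMinkowski fun y => L (a, y)

/-- The vertical differential of `½ L²`. On the fibres it is the Legendre transformation. -/
def fibreDeriv {n : ℕ} (L : EuclideanSpace ℝ (Fin n) × EuclideanSpace ℝ (Fin n) → ℝ)
    (q : EuclideanSpace ℝ (Fin n) × EuclideanSpace ℝ (Fin n)) : EuclideanSpace ℝ (Fin n) →L[ℝ] ℝ :=
  (1 / 2 : ℝ) • (fderiv ℝ (fun q => L q ^ 2) q).comp (ContinuousLinearMap.inr ℝ _ _)

theorem fibreDeriv_single {n : ℕ} (L : EuclideanSpace ℝ (Fin n) × EuclideanSpace ℝ (Fin n) → ℝ)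
    (q : EuclideanSpace ℝ (Fin n) × EuclideanSpace ℝ (Fin n)) (i : Fin n) :
    fibreDeriv L q (EuclideanSpace.single i 1) = 1 / 2 * pdy (fun q => L q ^ 2) i q := by
  simp [fibreDeriv, pdy]

namespace IsLocalFinsler

variable {n : ℕ} {U : Set (EuclideanSpace ℝ (Fin n))}
  {L : EuclideanSpace ℝ (Fin n) × EuclideanSpace ℝ (Fin n) → ℝ}
  {p : EuclideanSpace ℝ (Fin n) × EuclideanSpace ℝ (Fin n)}

/-! ### Smoothness, homogeneity and symmetry of the derivatives of L² -/

theorem isOpen_prod (hL : IsLocalFinsler U L) :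
    IsOpen (U ×ˢ ({0}ᶜ : Set (EuclideanSpace ℝ (Fin n)))) :=
  isOpen_prod_compl_zero hL.isOpen

theorem smooth_sq (hL : IsLocalFinsler U L) :
    ContDiffOn ℝ ∞ (fun q => L q ^ 2) (U ×ˢ {0}ᶜ) :=
  hL.smooth.pow 2

theorem smooth_pdy (hL : IsLocalFinsler U L) (i : Fin n) :
    ContDiffOn ℝ ∞ (pdy (fun q => L q ^ 2) i) (U ×ˢ {0}ᶜ) :=
  contDiffOn_pdy hL.isOpen_prod hL.smooth_sq i

theorem smooth_pdx (hL : IsLocalFinsler U L) (i : Fin n) :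
    ContDiffOn ℝ ∞ (pdx (fun q => L q ^ 2) i) (U ×ˢ {0}ᶜ) :=
  contDiffOn_pdx hL.isOpen_prod hL.smooth_sq i

theorem smooth_pdy_pdy (hL : IsLocalFinsler U L) (i j : Fin n) :
    ContDiffOn ℝ ∞ (pdy (pdy (fun q => L q ^ 2) i) j) (U ×ˢ {0}ᶜ) :=
  contDiffOn_pdy hL.isOpen_prod (hL.smooth_pdy i) j

theorem smooth_pdy_pdx (hL : IsLocalFinsler U L) (i j : Fin n) :
    ContDiffOn ℝ ∞ (pdy (pdx (fun q => L q ^ 2) i) j) (U ×ˢ {0}ᶜ) :=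
  contDiffOn_pdy hL.isOpen_prod (hL.smooth_pdx i) j

theorem smooth_gLow (hL : IsLocalFinsler U L) (i j : Fin n) :
    ContDiffOn ℝ ∞ (gLow L i j) (U ×ˢ {0}ᶜ) :=
  contDiffOn_const.mul (hL.smooth_pdy_pdy i j)

theorem homogeneous_sq (hL : IsLocalFinsler U L) :
    FibreHomogeneous U 2 fun q => L q ^ 2 := fun a ha y _ c hc => by
  have h : L (a, c • y) = c * L (a, y) := (hL.minkowski a ha).homogeneous y c hc
  simp only [h, mul_pow]
  norm_cast

theorem homogeneous_pdx (hL : IsLocalFinsler U L) (i : Fin n) :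
    FibreHomogeneous U 2 (pdx (fun q => L q ^ 2) i) :=
  hL.homogeneous_sq.pdx hL.isOpen hL.smooth_sq i

theorem homogeneous_pdy (hL : IsLocalFinsler U L) (i : Fin n) :
    FibreHomogeneous U 1 (pdy (fun q => L q ^ 2) i) :=
  hL.homogeneous_sq.pdy hL.isOpen hL.smooth_sq i

theorem homogeneous_pdy_pdx (hL : IsLocalFinsler U L) (i j : Fin n) :
    FibreHomogeneous U 1 (pdy (pdx (fun q => L q ^ 2) i) j) :=
  (hL.homogeneous_pdx i).pdy hL.isOpen (hL.smooth_pdx i) j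

theorem homogeneous_pdy_pdy (hL : IsLocalFinsler U L) (i j : Fin n) :
    FibreHomogeneous U 0 (pdy (pdy (fun q => L q ^ 2) i) j) :=
  (hL.homogeneous_pdy i).pdy hL.isOpen (hL.smooth_pdy i) j

theorem contDiffAt_of_mem (hL : IsLocalFinsler U L)
    {f : EuclideanSpace ℝ (Fin n) × EuclideanSpace ℝ (Fin n) → ℝ}
    (hf : ContDiffOn ℝ ∞ f (U ×ˢ {0}ᶜ)) (hp1 : p.1 ∈ U) (hp2 : p.2 ≠ 0) : ContDiffAt ℝ ∞ f p :=
  hf.contDiffAt (hL.isOpen_prod.mem_nhds ⟨hp1, hp2⟩)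

theorem differentiableAt_of_mem (hL : IsLocalFinsler U L)
    {f : EuclideanSpace ℝ (Fin n) × EuclideanSpace ℝ (Fin n) → ℝ}
    (hf : ContDiffOn ℝ ∞ f (U ×ˢ {0}ᶜ)) (hp1 : p.1 ∈ U) (hp2 : p.2 ≠ 0) :
    DifferentiableAt ℝ f p :=
  (hL.contDiffAt_of_mem hf hp1 hp2).differentiableAt (by simp)

theorem pdy_pdy_comm (hL : IsLocalFinsler U L)
    {f : EuclideanSpace ℝ (Fin n) × EuclideanSpace ℝ (Fin n) → ℝ}
    (hf : ContDiffOn ℝ ∞ f (U ×ˢ {0}ᶜ)) (hp1 : p.1 ∈ U) (hp2 : p.2 ≠ 0) (i j : Fin n) :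
    pdy (pdy f i) j p = pdy (pdy f j) i p :=
  fderiv_fderiv_apply_comm (contDiffAt_infty.1 (hL.contDiffAt_of_mem hf hp1 hp2) 2) _ _

theorem pdx_pdy_comm (hL : IsLocalFinsler U L)
    {f : EuclideanSpace ℝ (Fin n) × EuclideanSpace ℝ (Fin n) → ℝ}
    (hf : ContDiffOn ℝ ∞ f (U ×ˢ {0}ᶜ)) (hp1 : p.1 ∈ U) (hp2 : p.2 ≠ 0) (i j : Fin n) :
    pdx (pdy f i) j p = pdy (pdx f j) i p :=
  fderiv_fderiv_apply_comm (contDiffAt_infty.1 (hL.contDiffAt_of_mem hf hp1 hp2) 2) _ _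

theorem gLow_comm (hL : IsLocalFinsler U L) (hp1 : p.1 ∈ U) (hp2 : p.2 ≠ 0) (i j : Fin n) :
    gLow L i j p = gLow L j i p := by
  rw [gLow, gLow, hL.pdy_pdy_comm hL.smooth_sq hp1 hp2]

theorem gLow_eventuallyEq_comm (hL : IsLocalFinsler U L) (hp1 : p.1 ∈ U) (hp2 : p.2 ≠ 0)
    (i j : Fin n) : gLow L i j =ᶠ[𝓝 p] gLow L j i := by
  filter_upwards [hL.isOpen_prod.mem_nhds (show p ∈ U ×ˢ {0}ᶜ from ⟨hp1, hp2⟩)] with q hq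
  exact hL.gLow_comm hq.1 hq.2 i j

theorem pdy_gLow (hL : IsLocalFinsler U L) (hp1 : p.1 ∈ U) (hp2 : p.2 ≠ 0) (i j k : Fin n) :
    pdy (gLow L i j) k p = 2 * cartan L i j k p := by
  rw [cartan]
  refine (pdy_const_mul (hL.differentiableAt_of_mem (hL.smooth_pdy_pdy i j) hp1 hp2) _ _).trans ?_
  ring

theorem pdx_gLow (hL : IsLocalFinsler U L) (hp1 : p.1 ∈ U) (hp2 : p.2 ≠ 0) (i j k : Fin n) :
    pdx (gLow L i j) k p = 1 / 2 * pdy (pdy (pdx (fun q => L q ^ 2) k) i) j p := by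
  refine (pdx_const_mul (hL.differentiableAt_of_mem (hL.smooth_pdy_pdy i j) hp1 hp2) _ _).trans ?_
  rw [hL.pdx_pdy_comm (hL.smooth_pdy i) hp1 hp2]
  congr 1
  refine pdy_congr ?_ j
  filter_upwards [hL.isOpen_prod.mem_nhds (show p ∈ U ×ˢ {0}ᶜ from ⟨hp1, hp2⟩)] with q hq
  exact hL.pdx_pdy_comm hL.smooth_sq hq.1 hq.2 i k

theorem cartan_rotate (hL : IsLocalFinsler U L) (hp1 : p.1 ∈ U) (hp2 : p.2 ≠ 0) (i j k : Fin n) :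
    cartan L i j k p = cartan L k i j p := by
  rw [cartan, cartan, hL.pdy_pdy_comm (hL.smooth_pdy i) hp1 hp2]
  congr 1
  refine pdy_congr ?_ j
  filter_upwards [hL.isOpen_prod.mem_nhds (show p ∈ U ×ˢ {0}ᶜ from ⟨hp1, hp2⟩)] with q hq
  exact hL.pdy_pdy_comm hL.smooth_sq hq.1 hq.2 i k

/-! ### Contractions with y from Euler's identity -/

theorem sum_cartan (hL : IsLocalFinsler U L) (hp1 : p.1 ∈ U) (hp2 : p.2 ≠ 0) (i j : Fin n) :
    ∑ l, p.2 l * cartan L l i j p = 0 := by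
  have h := (hL.homogeneous_pdy_pdy i j).sum_mul_pdy hp1 hp2
    (hL.differentiableAt_of_mem (hL.smooth_pdy_pdy i j) hp1 hp2)
  simp only [Int.cast_zero, zero_mul] at h
  calc ∑ l, p.2 l * cartan L l i j p
      = ∑ l, 1 / 4 * (p.2 l * pdy (pdy (pdy (fun q => L q ^ 2) i) j) l p) :=
        Finset.sum_congr rfl fun l _ => by
          rw [← hL.cartan_rotate hp1 hp2 i j l, cartan]; ring
    _ = 0 := by rw [← Finset.mul_sum, h, mul_zero]

theorem sum_gLow (hL : IsLocalFinsler U L) (hp1 : p.1 ∈ U) (hp2 : p.2 ≠ 0) (i : Fin n) :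
    ∑ l, p.2 l * gLow L i l p = 1 / 2 * pdy (fun q => L q ^ 2) i p := by
  have h := (hL.homogeneous_pdy i).sum_mul_pdy hp1 hp2
    (hL.differentiableAt_of_mem (hL.smooth_pdy i) hp1 hp2)
  simp only [Int.cast_one, one_mul] at h
  rw [← h, Finset.mul_sum]
  exact Finset.sum_congr rfl fun l _ => by rw [gLow]; ring

theorem sum_pdx_gLow (hL : IsLocalFinsler U L) (hp1 : p.1 ∈ U) (hp2 : p.2 ≠ 0) (i k : Fin n) :
    ∑ l, p.2 l * pdx (gLow L l i) k p = 1 / 2 * pdy (pdx (fun q => L q ^ 2) k) i p := by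
  have h := (hL.homogeneous_pdy_pdx k i).sum_mul_pdy hp1 hp2
    (hL.differentiableAt_of_mem (hL.smooth_pdy_pdx k i) hp1 hp2)
  simp only [Int.cast_one, one_mul] at h
  rw [← h, Finset.mul_sum]
  refine Finset.sum_congr rfl fun l _ => ?_
  rw [hL.pdx_gLow hp1 hp2, hL.pdy_pdy_comm (hL.smooth_pdx k) hp1 hp2]
  ring

theorem sum_pdy_pdx (hL : IsLocalFinsler U L) (hp1 : p.1 ∈ U) (hp2 : p.2 ≠ 0) (k : Fin n) :
    ∑ l, p.2 l * pdy (pdx (fun q => L q ^ 2) k) l p = 2 * pdx (fun q => L q ^ 2) k p := by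
  have h := (hL.homogeneous_pdx k).sum_mul_pdy hp1 hp2
    (hL.differentiableAt_of_mem (hL.smooth_pdx k) hp1 hp2)
  exact_mod_cast h

/-- Contracting y with an index of g kills the vertical part of δ, since yˡ Cₗᵢₘ = 0. Thus δ acts as
∂/∂x. -/
theorem sum_delta_gLow (hL : IsLocalFinsler U L) (hp1 : p.1 ∈ U) (hp2 : p.2 ≠ 0) (i k : Fin n) :
    ∑ l, p.2 l * delta L (gLow L l i) k p = 1 / 2 * pdy (pdx (fun q => L q ^ 2) k) i p := by
  have h : ∑ l, p.2 l * ∑ m, nonlinConn L m k p * pdy (gLow L l i) m p = 0 := by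
    simp only [Finset.mul_sum]
    rw [Finset.sum_comm]
    refine Finset.sum_eq_zero fun m _ => ?_
    calc ∑ l, p.2 l * (nonlinConn L m k p * pdy (gLow L l i) m p)
        = 2 * nonlinConn L m k p * ∑ l, p.2 l * cartan L l i m p := by
          rw [Finset.mul_sum]
          exact Finset.sum_congr rfl fun l _ => by rw [hL.pdy_gLow hp1 hp2]; ring
      _ = 0 := by rw [hL.sum_cartan hp1 hp2, mul_zero]
  simp only [delta, mul_sub, Finset.sum_sub_distrib, h, sub_zero]
  exact hL.sum_pdx_gLow hp1 hp2 i k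

/-! ### The vertical differential, the fundamental tensor and its inverse matrix -/

theorem contDiffOn_fibreDeriv (hL : IsLocalFinsler U L) :
    ContDiffOn ℝ ∞ (fibreDeriv L) (U ×ˢ {0}ᶜ) :=
  ((hL.smooth_sq.fderiv_of_isOpen hL.isOpen_prod (by simp)).clm_comp contDiffOn_const).const_smul _

theorem fderiv_sq_fibre (hL : IsLocalFinsler U L) (hp1 : p.1 ∈ U) (hp2 : p.2 ≠ 0) :
    (1 / 2 : ℝ) • fderiv ℝ (fun y => L (p.1, y) ^ 2) p.2 = fibreDeriv L p := by
  have h1 : HasFDerivAt (fun y => L (p.1, y) ^ 2)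
      ((fderiv ℝ (fun q => L q ^ 2) p).comp (ContinuousLinearMap.inr ℝ _ _)) p.2 :=
    HasFDerivAt.comp (g := fun q => L q ^ 2) (f := fun y => (p.1, y)) p.2
      (hL.differentiableAt_of_mem hL.smooth_sq hp1 hp2).hasFDerivAt
      (hasFDerivAt_prodMk_right p.1 p.2)
  rw [h1.fderiv, fibreDeriv]

theorem fundTensor_self_eq (hL : IsLocalFinsler U L) (hp1 : p.1 ∈ U) (hp2 : p.2 ≠ 0) :
    fundTensor (fun y => L (p.1, y)) p.2 p.2 = fibreDeriv L p := by
  rw [(hL.minkowski p.1 hp1).fundTensor_self hp2, hL.fderiv_sq_fibre hp1 hp2]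

theorem fundTensor_eq_fderiv (hL : IsLocalFinsler U L) (hp1 : p.1 ∈ U) (hp2 : p.2 ≠ 0)
    (v : EuclideanSpace ℝ (Fin n)) :
    fundTensor (fun y => L (p.1, y)) p.2 v = fderiv ℝ (fibreDeriv L) p (0, v) := by
  have hd : DifferentiableAt ℝ (fibreDeriv L) p :=
    (hL.contDiffOn_fibreDeriv.contDiffAt (hL.isOpen_prod.mem_nhds ⟨hp1, hp2⟩)).differentiableAt
      (by simp)
  have h1 : HasFDerivAt (fun y => fibreDeriv L (p.1, y))
      ((fderiv ℝ (fibreDeriv L) p).comp (ContinuousLinearMap.inr ℝ _ _)) p.2 :=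
    HasFDerivAt.comp (g := fibreDeriv L) (f := fun y => (p.1, y)) p.2 hd.hasFDerivAt
      (hasFDerivAt_prodMk_right p.1 p.2)
  have h2 : (fun y => (1 / 2 : ℝ) • fderiv ℝ (fun y => L (p.1, y) ^ 2) y) =ᶠ[𝓝 p.2]
      fun y => fibreDeriv L (p.1, y) := by
    filter_upwards [isOpen_compl_singleton.mem_nhds hp2] with y hy
    exact hL.fderiv_sq_fibre (p := (p.1, y)) hp1 hy
  have h3 := h2.fderiv_eq (𝕜 := ℝ)
  rw [fderiv_fun_const_smul (((hL.minkowski p.1 hp1).contDiffAt_fderiv_sq hp2).differentiableAt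
    (by simp)), h1.fderiv] at h3
  rw [fundTensor, h3]
  simp

theorem gLow_eq_fundTensor (hL : IsLocalFinsler U L) (hp1 : p.1 ∈ U) (hp2 : p.2 ≠ 0)
    (i j : Fin n) :
    gLow L i j p = fundTensor (fun y => L (p.1, y)) p.2 (EuclideanSpace.single j 1)
      (EuclideanSpace.single i 1) := by
  have hd : DifferentiableAt ℝ (fibreDeriv L) p :=
    (hL.contDiffOn_fibreDeriv.contDiffAt (hL.isOpen_prod.mem_nhds ⟨hp1, hp2⟩)).differentiableAt
      (by simp)
  have h1 : (fun q => fibreDeriv L q (EuclideanSpace.single i 1))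
      = fun q => 1 / 2 * pdy (fun q => L q ^ 2) i q := funext fun q => fibreDeriv_single L q i
  have h2 := pdy_const_mul (hL.differentiableAt_of_mem (hL.smooth_pdy i) hp1 hp2) (1 / 2) j
  rw [gLow, ← h2, ← h1, hL.fundTensor_eq_fderiv hp1 hp2, pdy,
    fderiv_clm_apply hd (differentiableAt_const _)]
  simp

/-- A kernel vector v of the matrix would satisfy g(v, v) = 0, against positive definiteness. -/
theorem det_gLow_ne_zero (hL : IsLocalFinsler U L) (hp1 : p.1 ∈ U) (hp2 : p.2 ≠ 0) :
    (Matrix.of fun a b => gLow L a b p : Matrix (Fin n) (Fin n) ℝ).det ≠ 0 := by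
  rw [Ne, ← Matrix.exists_mulVec_eq_zero_iff]
  rintro ⟨v, hv, h⟩
  let v' : EuclideanSpace ℝ (Fin n) := WithLp.toLp 2 v
  have hv' : v' ≠ 0 := fun h0 => hv (congrArg WithLp.ofLp h0)
  have hpos := (hL.minkowski p.1 hp1).posDef p.2 v' hp2 hv'
  have h1 : ∀ i, fundTensor (fun y => L (p.1, y)) p.2 v' (EuclideanSpace.single i 1) = 0 := by
    intro i
    have h2 := congrFun h i
    rw [map_eq_sum_single (fundTensor (fun y => L (p.1, y)) p.2) v', sum_apply]
    simp only [smul_apply, ← hL.gLow_eq_fundTensor hp1 hp2]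
    simpa [Matrix.mulVec, dotProduct, v', mul_comm] using h2
  rw [map_eq_sum_single (fundTensor (fun y => L (p.1, y)) p.2 v') v'] at hpos
  simp [h1] at hpos

theorem sum_gUp_gLow (hL : IsLocalFinsler U L) (hp1 : p.1 ∈ U) (hp2 : p.2 ≠ 0)
    (v : Fin n → ℝ) (i : Fin n) :
    ∑ l, gUp L i l p * ∑ m, gLow L l m p * v m = v i := by
  have h := congrFun (congrArg (fun B => Matrix.mulVec B v)
    (Matrix.nonsing_inv_mul _ (hL.det_gLow_ne_zero hp1 hp2).isUnit)) i
  rw [← Matrix.mulVec_mulVec] at h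
  simpa [Matrix.mulVec, dotProduct, gUp, Matrix.one_apply] using h

theorem sum_gLow_gUp (hL : IsLocalFinsler U L) (hp1 : p.1 ∈ U) (hp2 : p.2 ≠ 0)
    (v : Fin n → ℝ) (i : Fin n) :
    ∑ l, gLow L i l p * ∑ m, gUp L l m p * v m = v i := by
  have h := congrFun (congrArg (fun B => Matrix.mulVec B v)
    (Matrix.mul_nonsing_inv _ (hL.det_gLow_ne_zero hp1 hp2).isUnit)) i
  rw [← Matrix.mulVec_mulVec] at h
  simpa [Matrix.mulVec, dotProduct, gUp, Matrix.one_apply] using h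

theorem gUp_comm (hL : IsLocalFinsler U L) (hp1 : p.1 ∈ U) (hp2 : p.2 ≠ 0) (i j : Fin n) :
    gUp L i j p = gUp L j i p := by
  have h : (Matrix.of fun a b => gLow L a b p : Matrix (Fin n) (Fin n) ℝ).IsSymm :=
    Matrix.ext fun a b => hL.gLow_comm hp1 hp2 b a
  have h2 := congrFun (congrFun (Matrix.transpose_nonsing_inv
    (Matrix.of fun a b => gLow L a b p : Matrix (Fin n) (Fin n) ℝ)) j) i
  rw [h.eq] at h2
  exact h2

theorem differentiableAt_gUp (hL : IsLocalFinsler U L) (hp1 : p.1 ∈ U) (hp2 : p.2 ≠ 0)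
    (i j : Fin n) : DifferentiableAt ℝ (gUp L i j) p :=
  differentiableAt_inv_apply (A := fun q => Matrix.of fun a b => gLow L a b q)
    (fun a b => hL.differentiableAt_of_mem (hL.smooth_gLow a b) hp1 hp2)
    (hL.det_gLow_ne_zero hp1 hp2) i j

theorem homogeneous_gUp (hL : IsLocalFinsler U L) (i j : Fin n) :
    FibreHomogeneous U 0 (gUp L i j) := fun a ha y hy c hc => by
  have h : ∀ k l, gLow L k l (a, c • y) = gLow L k l (a, y) := fun k l => by
    rw [gLow, gLow, hL.homogeneous_pdy_pdy k l a ha y hy c hc, zpow_zero, one_mul]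
  simp only [gUp, h, zpow_zero, one_mul]

/-! ### Spray, nonlinear connection and Chern coefficients -/

theorem differentiableAt_spray (hL : IsLocalFinsler U L) (hp1 : p.1 ∈ U) (hp2 : p.2 ≠ 0)
    (i : Fin n) : DifferentiableAt ℝ (spray L i) p := by
  refine (DifferentiableAt.fun_sum fun l _ => ?_).const_mul _
  refine (hL.differentiableAt_gUp hp1 hp2 i l).mul (DifferentiableAt.sub
    (DifferentiableAt.fun_sum fun k _ => ?_) (hL.differentiableAt_of_mem (hL.smooth_pdx l) hp1 hp2))
  refine (hL.differentiableAt_of_mem (hL.smooth_pdy_pdx k l) hp1 hp2).mul ?_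
  fun_prop

theorem homogeneous_spray (hL : IsLocalFinsler U L) (i : Fin n) :
    FibreHomogeneous U 2 (spray L i) := fun a ha y hy c hc => by
  simp only [spray, hL.homogeneous_gUp _ _ a ha y hy c hc, hL.homogeneous_pdx _ a ha y hy c hc,
    hL.homogeneous_pdy_pdx _ _ a ha y hy c hc, PiLp.smul_apply, smul_eq_mul, Finset.mul_sum]
  refine Finset.sum_congr rfl fun l _ => ?_
  have h : ∑ k, c ^ (1 : ℤ) * pdy (pdx (fun q => L q ^ 2) k) l (a, y) * (c * y k)
      = c ^ (2 : ℤ) * ∑ k, pdy (pdx (fun q => L q ^ 2) k) l (a, y) * y k := by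
    rw [Finset.mul_sum]
    refine Finset.sum_congr rfl fun k _ => ?_
    rw [zpow_one, zpow_ofNat]
    ring
  rw [h, zpow_zero]
  ring

theorem sum_nonlinConn (hL : IsLocalFinsler U L) (hp1 : p.1 ∈ U) (hp2 : p.2 ≠ 0) (i : Fin n) :
    ∑ j, p.2 j * nonlinConn L i j p = 2 * spray L i p := by
  have h := (hL.homogeneous_spray i).sum_mul_pdy hp1 hp2 (hL.differentiableAt_spray hp1 hp2 i)
  exact_mod_cast h

/-- Lowering the index cancels the inverse metric in the definition of the spray. -/
theorem sum_gLow_spray (hL : IsLocalFinsler U L) (hp1 : p.1 ∈ U) (hp2 : p.2 ≠ 0) (r : Fin n) :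
    ∑ k, gLow L r k p * (2 * spray L k p) = 1 / 2 *
      ((∑ k, p.2 k * pdy (pdx (fun q => L q ^ 2) k) r p) - pdx (fun q => L q ^ 2) r p) := by
  have h := hL.sum_gLow_gUp hp1 hp2 (fun l =>
    (∑ k, pdy (pdx (fun q => L q ^ 2) k) l p * p.2 k) - pdx (fun q => L q ^ 2) l p) r
  simp only [mul_comm (p.2 _)]
  rw [← h, Finset.mul_sum]
  refine Finset.sum_congr rfl fun k _ => ?_
  rw [spray]
  ring

/-- Contraction of the Chern coefficients with `½ [L²]_{yᵏ} = g_{kl} yˡ`. -/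
theorem sum_chern (hL : IsLocalFinsler U L) (hp1 : p.1 ∈ U) (hp2 : p.2 ≠ 0) (i j : Fin n) :
    ∑ k, chern L k i j p * (1 / 2 * pdy (fun q => L q ^ 2) k p)
      = 1 / 4 * pdy (pdx (fun q => L q ^ 2) j) i p + 1 / 4 * pdy (pdx (fun q => L q ^ 2) i) j p
        - 1 / 2 * ∑ l, p.2 l * delta L (gLow L i j) l p := by
  -- Raising the index of ½[L²]_{yᵏ} returns yˡ, which absorbs the inverse metric inside Γ.
  have h1 : ∀ l, ∑ k, gUp L k l p * (1 / 2 * pdy (fun q => L q ^ 2) k p) = p.2 l := fun l => by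
    rw [← hL.sum_gUp_gLow hp1 hp2 (fun l => p.2 l) l]
    refine Finset.sum_congr rfl fun k _ => ?_
    rw [hL.gUp_comm hp1 hp2, ← hL.sum_gLow hp1 hp2]
    simp only [mul_comm (p.2 _)]
  have h2 : ∑ k, chern L k i j p * (1 / 2 * pdy (fun q => L q ^ 2) k p)
      = 1 / 2 * ∑ l, p.2 l *
        (delta L (gLow L l i) j p + delta L (gLow L l j) i p - delta L (gLow L i j) l p) := by
    simp only [chern, Finset.mul_sum, Finset.sum_mul]
    rw [Finset.sum_comm]
    refine Finset.sum_congr rfl fun l _ => ?_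
    rw [← h1 l, Finset.sum_mul, Finset.mul_sum]
    exact Finset.sum_congr rfl fun k _ => by ring
  rw [h2]
  simp only [mul_sub, mul_add, Finset.sum_sub_distrib, Finset.sum_add_distrib,
    hL.sum_delta_gLow hp1 hp2]
  ring

/-- Unlike in `sum_delta_gLow`, y is contracted with the direction of differentiation, so the
vertical part survives: yˡ Nᵐₗ = 2Gᵐ. -/
theorem sum_delta_gLow_base (hL : IsLocalFinsler U L) (hp1 : p.1 ∈ U) (hp2 : p.2 ≠ 0)
    (i j : Fin n) :
    ∑ l, p.2 l * delta L (gLow L i j) l p = ∑ l, p.2 l * pdx (gLow L i j) l p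
      - ∑ m, 2 * spray L m p * pdy (gLow L i j) m p := by
  simp only [delta, mul_sub, Finset.sum_sub_distrib, Finset.mul_sum]
  rw [Finset.sum_comm (f := fun l m => p.2 l * (nonlinConn L m l p * pdy (gLow L i j) m p))]
  congr 1
  refine Finset.sum_congr rfl fun m _ => ?_
  rw [← hL.sum_nonlinConn hp1 hp2, Finset.sum_mul]
  exact Finset.sum_congr rfl fun l _ => by ring

/-- Derivatives of a covector field `y ↦ ½ [L²]_{yⁱ}` along a vector field. -/
theorem fderiv_pdy_along (hL : IsLocalFinsler U L)
    {V : EuclideanSpace ℝ (Fin n) → EuclideanSpace ℝ (Fin n)} {a : EuclideanSpace ℝ (Fin n)}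
    (ha : a ∈ U) (hV0 : V a ≠ 0) (hV : DifferentiableAt ℝ V a) (i j : Fin n) :
    fderiv ℝ (fun b => 1 / 2 * pdy (fun q => L q ^ 2) i (b, V b)) a (EuclideanSpace.single j 1)
      = 1 / 2 * pdy (pdx (fun q => L q ^ 2) j) i (a, V a)
        + ∑ m, gLow L i m (a, V a) * fderiv ℝ V a (EuclideanSpace.single j 1) m := by
  have hd : DifferentiableAt ℝ (pdy (fun q => L q ^ 2) i) (a, V a) :=
    hL.differentiableAt_of_mem (hL.smooth_pdy i) ha hV0
  have h1 : HasFDerivAt (fun b => pdy (fun q => L q ^ 2) i (b, V b))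
      ((fderiv ℝ (pdy (fun q => L q ^ 2) i) (a, V a)).comp
        ((ContinuousLinearMap.id ℝ _).prod (fderiv ℝ V a))) a :=
    HasFDerivAt.comp (g := pdy (fun q => L q ^ 2) i) (f := fun b => (b, V b)) a hd.hasFDerivAt
      ((hasFDerivAt_id a).prodMk hV.hasFDerivAt)
  rw [(h1.const_mul (1 / 2)).fderiv, ← hL.pdx_pdy_comm hL.smooth_sq (p := (a, V a)) ha hV0]
  simp only [smul_apply, ContinuousLinearMap.comp_apply, ContinuousLinearMap.prod_apply,
    ContinuousLinearMap.id_apply, fderiv_eq_sum, smul_eq_mul, mul_add, gLow, Finset.mul_sum]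
  congr 1
  · simp
  · exact Finset.sum_congr rfl fun m _ => by ring

end IsLocalFinsler

/-- The Hessian formula in coordinates, for a vector field `V` without zeros that is Legendre dual
to the differential of `w`. -/
theorem IsLocalFinsler.secondCov_eq_lieG {n : ℕ} {U : Set (EuclideanSpace ℝ (Fin n))}
    {L : EuclideanSpace ℝ (Fin n) × EuclideanSpace ℝ (Fin n) → ℝ} (hL : IsLocalFinsler U L)
    {V : EuclideanSpace ℝ (Fin n) → EuclideanSpace ℝ (Fin n)} {w : EuclideanSpace ℝ (Fin n) → ℝ}
    {a : EuclideanSpace ℝ (Fin n)} (ha : a ∈ U) (hV0 : V a ≠ 0) (hV : DifferentiableAt ℝ V a)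
    (hw : ContDiffAt ℝ 2 w a) (hdual : ∀ᶠ b in 𝓝 a, fderiv ℝ w b = fibreDeriv L (b, V b))
    (i j : Fin n) :
    secondCov L w i j (a, V a) = 1 / 2 * lieG L V i j (a, V a)
      - ∑ m, ∑ r, V a m * secondCov L w r m (a, V a) * cartanUp L r i j (a, V a) := by
  set p : EuclideanSpace ℝ (Fin n) × EuclideanSpace ℝ (Fin n) := (a, V a) with hp
  have hp1 : p.1 ∈ U := ha
  have hp2 : p.2 ≠ 0 := hV0
  set W : Fin n → Fin n → ℝ := fun i j =>
    fderiv ℝ (fun a => fderiv ℝ w a (EuclideanSpace.single i 1)) a (EuclideanSpace.single j 1)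
    with hW
  set DV : Fin n → Fin n → ℝ := fun m j => fderiv ℝ V a (EuclideanSpace.single j 1) m with hDV
  set Q : Fin n → Fin n → ℝ := fun k i => pdy (pdx (fun q => L q ^ 2) k) i p with hQ
  -- The duality relation holds on a neighbourhood, so it may be differentiated in direction j.
  have hWeq : ∀ i j, W i j = 1 / 2 * Q j i + ∑ m, gLow L i m p * DV m j := fun i j => by
    have h : (fun b => fderiv ℝ w b (EuclideanSpace.single i 1)) =ᶠ[𝓝 a]
        fun b => 1 / 2 * pdy (fun q => L q ^ 2) i (b, V b) :=
      hdual.mono fun b hb => by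
        change fderiv ℝ w b _ = _
        rw [hb, fibreDeriv_single]
    simp only [hW]
    rw [h.fderiv_eq]
    exact hL.fderiv_pdy_along ha hV0 hV i j
  have hWsymm : ∀ i j, W i j = W j i := fun i j => fderiv_fderiv_apply_comm hw _ _
  have hS : ∀ i j, secondCov L w i j p = W i j - (1 / 4 * Q j i + 1 / 4 * Q i j
      - 1 / 2 * ∑ l, p.2 l * delta L (gLow L i j) l p) := fun i j => by
    rw [secondCov_eq L hw, ← hL.sum_chern hp1 hp2]
    congr 1
    refine Finset.sum_congr rfl fun k _ => ?_
    rw [← fibreDeriv_single]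
    exact congrArg (fun A => chern L k i j p * A (EuclideanSpace.single k 1)) hdual.self_of_nhds
  have hX : ∀ k, fderiv ℝ V a p.2 k = ∑ m, p.2 m * DV k m := fun k => by
    rw [map_eq_sum_single (fderiv ℝ V a) p.2]
    simp [hDV]
  -- The mixed derivatives of L² left after contraction assemble, by Euler's identity in degree two,
  -- into the lowered spray.
  have hZ : ∀ r, ∑ m, p.2 m * secondCov L w r m p
      = ∑ k, gLow L r k p * (fderiv ℝ V a p.2 k + 2 * spray L k p) := fun r => by
    have h1 : ∑ m, p.2 m * ∑ l, p.2 l * delta L (gLow L r m) l p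
        = ∑ l, p.2 l * (1 / 2 * Q l r) := by
      simp only [Finset.mul_sum]
      rw [Finset.sum_comm]
      refine Finset.sum_congr rfl fun l _ => ?_
      rw [← hL.sum_delta_gLow hp1 hp2 r l, Finset.mul_sum]
      refine Finset.sum_congr rfl fun m _ => ?_
      rw [delta_congr L (hL.gLow_eventuallyEq_comm hp1 hp2 r m)]
      ring
    have h2 : ∑ m, p.2 m * ∑ k, gLow L r k p * DV k m
        = ∑ k, gLow L r k p * fderiv ℝ V a p.2 k := by
      simp only [hX, Finset.mul_sum]
      rw [Finset.sum_comm]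
      exact Finset.sum_congr rfl fun k _ => Finset.sum_congr rfl fun m _ => by ring
    have h3 := hL.sum_pdy_pdx hp1 hp2 r
    have h4 := hL.sum_gLow_spray hp1 hp2 r
    have h5 : ∑ m, p.2 m * secondCov L w r m p = ∑ m, (1 / 4 * (p.2 m * Q m r)
        + p.2 m * ∑ k, gLow L r k p * DV k m - 1 / 4 * (p.2 m * Q r m)
        + 1 / 2 * (p.2 m * ∑ l, p.2 l * delta L (gLow L r m) l p)) :=
      Finset.sum_congr rfl fun m _ => by rw [hS, hWeq]; ring
    have h6 : ∑ l, p.2 l * (1 / 2 * Q l r) = 1 / 2 * ∑ l, p.2 l * Q l r := by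
      rw [Finset.mul_sum]; exact Finset.sum_congr rfl fun l _ => by ring
    rw [h5]
    simp only [mul_add, Finset.sum_add_distrib, Finset.sum_sub_distrib, ← Finset.mul_sum, h1, h2,
      h4, h6]
    rw [h3]
    ring
  have hC : ∑ m, ∑ r, V a m * secondCov L w r m p * cartanUp L r i j p
      = 1 / 2 * ∑ k, (fderiv ℝ V a p.2 k + 2 * spray L k p) * pdy (gLow L i j) k p := by
    have h1 : ∑ m, ∑ r, V a m * secondCov L w r m p * cartanUp L r i j p
        = ∑ r, (∑ m, p.2 m * secondCov L w r m p) * cartanUp L r i j p := by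
      rw [Finset.sum_comm]
      exact Finset.sum_congr rfl fun r _ => by rw [Finset.sum_mul]
    rw [h1]
    -- ∂gᵢⱼ/∂yᵏ = 2Cₖᵢⱼ, with the first index of C raised and lowered again so as to meet the
    -- lowered index in `hZ`.
    have h2 : ∀ k, pdy (gLow L i j) k p = 2 * ∑ r, gLow L k r p * cartanUp L r i j p := fun k => by
      rw [hL.pdy_gLow hp1 hp2, hL.cartan_rotate hp1 hp2 i j k,
        ← hL.sum_gLow_gUp hp1 hp2 (fun l => cartan L l i j p) k]
      rfl
    simp only [hZ, h2, Finset.sum_mul, Finset.mul_sum]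
    rw [Finset.sum_comm]
    refine Finset.sum_congr rfl fun k _ => Finset.sum_congr rfl fun r _ => ?_
    rw [hL.gLow_comm hp1 hp2 r k]
    ring
  have hG : ∑ b, DV b j * gLow L i b p = ∑ m, gLow L i m p * DV m j :=
    Finset.sum_congr rfl fun b _ => mul_comm _ _
  have hG' : ∑ b, DV b i * gLow L b j p = ∑ m, gLow L j m p * DV m i :=
    Finset.sum_congr rfl fun b _ => by rw [hL.gLow_comm hp1 hp2 b j, mul_comm]
  have hlie := lieG_eq (p := p) L V i j
  rw [hC, hlie, hS, hL.sum_delta_gLow_base hp1 hp2]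
  -- Both orders of the indices are used: their average symmetrises g·DV and cancels the mixed
  -- derivatives of L².
  have h1 := hWeq i j
  have h2 := hWeq j i
  rw [← hWsymm i j] at h2
  change ∑ b, fderiv ℝ V p.1 (EuclideanSpace.single j 1) b * gLow L i b p = _ at hG
  change ∑ b, fderiv ℝ V p.1 (EuclideanSpace.single i 1) b * gLow L b j p = _ at hG'
  rw [hG, hG']
  have h3 : ∑ k, (fderiv ℝ V a p.2 k + 2 * spray L k p) * pdy (gLow L i j) k p
      = ∑ k, fderiv ℝ V p.1 p.2 k * pdy (gLow L i j) k p
        + ∑ k, 2 * spray L k p * pdy (gLow L i j) k p := by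
    rw [← Finset.sum_add_distrib]
    exact Finset.sum_congr rfl fun k _ => add_mul _ _ _
  have h4 : ∑ k, V p.1 k * pdx (gLow L i j) k p = ∑ k, p.2 k * pdx (gLow L i j) k p := rfl
  rw [h3, h4]
  linarith

/-! ### Linear changes of coordinates -/

section LinearChange

variable {E E' : Type*} [NormedAddCommGroup E] [NormedSpace ℝ E] [NormedAddCommGroup E']
  [NormedSpace ℝ E'] {f : E' → ℝ}

/-- Second-order chain rule; linearity of A removes the term with its second derivative. The point
is nonzero because f² need not be C² at the origin. -/
theorem fundTensor_comp_equiv (hf : ContDiffOn ℝ ∞ f {0}ᶜ) (A : E ≃L[ℝ] E') {v : E} (hv : v ≠ 0)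
    (w z : E) : fundTensor (fun y => f (A y)) v w z = fundTensor f (A v) (A w) (A z) := by
  have hsq : ∀ y : E', y ≠ 0 → ContDiffAt ℝ ∞ (fun w => f w ^ 2) y := fun y hy =>
    (hf.contDiffAt (isOpen_compl_singleton.mem_nhds hy)).pow 2
  have hA : ∀ y : E, y ≠ 0 → A y ≠ 0 := fun y hy h => hy (A.map_eq_zero_iff.1 h)
  have h1 : fderiv ℝ (fun y => f (A y) ^ 2) =ᶠ[𝓝 v]
      fun y => (fderiv ℝ (fun w => f w ^ 2) (A y)).comp (A : E →L[ℝ] E') := by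
    filter_upwards [isOpen_compl_singleton.mem_nhds hv] with y hy
    exact (HasFDerivAt.comp (g := fun w => f w ^ 2) y
      ((hsq _ (hA y hy)).differentiableAt (by simp)).hasFDerivAt A.hasFDerivAt).fderiv
  have h2 : HasFDerivAt (fderiv ℝ fun w => f w ^ 2) (fderiv ℝ (fderiv ℝ fun w => f w ^ 2) (A v))
      (A v) :=
    (((hsq _ (hA v hv)).fderiv_right (m := ∞) (by simp)).differentiableAt (by simp)).hasFDerivAt
  have h3 : HasFDerivAt (fun y => fderiv ℝ (fun w => f w ^ 2) (A y))
      ((fderiv ℝ (fderiv ℝ fun w => f w ^ 2) (A v)).comp (A : E →L[ℝ] E')) v :=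
    HasFDerivAt.comp v h2 A.hasFDerivAt
  have h4 := (h3.clm_comp (hasFDerivAt_const (A : E →L[ℝ] E') v)).fderiv
  rw [fundTensor, h1.fderiv_eq, h4]
  simp [fundTensor]

theorem IsMinkowski.comp_equiv (hf : IsMinkowski f) (A : E ≃L[ℝ] E') :
    IsMinkowski fun y => f (A y) where
  nonneg v := hf.nonneg _
  smooth := hf.smooth.comp A.contDiff.contDiffOn fun y hy h => hy (A.map_eq_zero_iff.1 h)
  homogeneous v c hc := by rw [map_smul, hf.homogeneous _ c hc]
  posDef v w hv hw := by
    rw [fundTensor_comp_equiv hf.smooth A hv]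
    exact hf.posDef _ _ (fun h => hv (A.map_eq_zero_iff.1 h)) fun h => hw (A.map_eq_zero_iff.1 h)

end LinearChange

/-! ### Regularity of the inverse Legendre transformation -/

theorem exists_contDiffAt_localInverse {E E' : Type*} [NormedAddCommGroup E] [NormedSpace ℝ E]
    [CompleteSpace E] [NormedAddCommGroup E'] [NormedSpace ℝ E'] {f : E → E'} {f' : E ≃L[ℝ] E'}
    {a : E} (hf : ContDiffAt ℝ ∞ f a) (hf' : HasFDerivAt f (f' : E →L[ℝ] E') a) :
    ∃ r : E' → E, r (f a) = a ∧ ContDiffAt ℝ ∞ r (f a) ∧ ∀ᶠ y in 𝓝 (f a), f (r y) = y :=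
  ⟨hf.localInverse hf' (by simp), hf.localInverse_apply_image hf' (by simp),
    hf.to_localInverse hf' (by simp), (hf.hasStrictFDerivAt' hf' (by simp)).eventually_right_inverse⟩

theorem exists_equiv_of_injective {E E' : Type*} [NormedAddCommGroup E] [NormedSpace ℝ E]
    [FiniteDimensional ℝ E] [NormedAddCommGroup E'] [NormedSpace ℝ E'] [FiniteDimensional ℝ E']
    (D : E →L[ℝ] E') (hD : Function.Injective D)
    (h : Module.finrank ℝ E = Module.finrank ℝ E') : ∃ A : E ≃L[ℝ] E', (A : E →L[ℝ] E') = D :=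
  ⟨(LinearEquiv.ofInjectiveOfFinrankEq (D : E →ₗ[ℝ] E') hD h).toContinuousLinearEquiv,
    ContinuousLinearMap.ext fun _ => rfl⟩

/-- Inverse function theorem for (x, y) ↦ (x, ½ d_y L²). Continuity of V is not assumed: near a the
smooth local inverse is identified with V by injectivity of the Legendre transformation on each
fibre. -/
theorem IsLocalFinsler.contDiffAt_of_legendre {n : ℕ} {U : Set (EuclideanSpace ℝ (Fin n))}
    {L : EuclideanSpace ℝ (Fin n) × EuclideanSpace ℝ (Fin n) → ℝ} (hL : IsLocalFinsler U L)
    {V : EuclideanSpace ℝ (Fin n) → EuclideanSpace ℝ (Fin n)}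
    {θ : EuclideanSpace ℝ (Fin n) → EuclideanSpace ℝ (Fin n) →L[ℝ] ℝ}
    {a : EuclideanSpace ℝ (Fin n)} (ha : a ∈ U) (hV0 : V a ≠ 0) (hθ : ContDiffAt ℝ 1 θ a)
    (hV : ∀ b ∈ U, fundTensor (fun y => L (b, y)) (V b) (V b) = θ b) : ContDiffAt ℝ 1 V a := by
  set p : EuclideanSpace ℝ (Fin n) × EuclideanSpace ℝ (Fin n) := (a, V a) with hp
  have hp1 : p.1 ∈ U := ha
  have hp2 : p.2 ≠ 0 := hV0
  have hΩ := hL.isOpen_prod.mem_nhds (show p ∈ U ×ˢ {0}ᶜ from ⟨hp1, hp2⟩)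
  let Ψ : EuclideanSpace ℝ (Fin n) × EuclideanSpace ℝ (Fin n) →
      EuclideanSpace ℝ (Fin n) × (EuclideanSpace ℝ (Fin n) →L[ℝ] ℝ) :=
    fun q => (q.1, fibreDeriv L q)
  have hψ : ContDiffAt ℝ ∞ (fibreDeriv L) p := hL.contDiffOn_fibreDeriv.contDiffAt hΩ
  have hΨ : ContDiffAt ℝ ∞ Ψ p := contDiffAt_fst.prodMk hψ
  let D := (ContinuousLinearMap.fst ℝ (EuclideanSpace ℝ (Fin n))
    (EuclideanSpace ℝ (Fin n))).prod (fderiv ℝ (fibreDeriv L) p)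
  have hD : HasFDerivAt Ψ D p :=
    hasFDerivAt_fst.prodMk (hψ.differentiableAt (by simp)).hasFDerivAt
  -- D is block triangular with the identity and the fundamental tensor on the diagonal.
  have hinj : Function.Injective D := by
    rw [injective_iff_map_eq_zero]
    rintro ⟨v, w⟩ h
    have h1 : v = 0 := congrArg Prod.fst h
    have h2 : fderiv ℝ (fibreDeriv L) p (v, w) = 0 := congrArg Prod.snd h
    subst h1
    rw [← hL.fundTensor_eq_fderiv hp1 hp2] at h2
    by_contra hw
    have hw0 : w ≠ 0 := fun h0 => hw (by simp [h0])
    have := (hL.minkowski p.1 hp1).posDef p.2 w hp2 hw0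
    simp [h2] at this
  have hrank : Module.finrank ℝ (EuclideanSpace ℝ (Fin n) × EuclideanSpace ℝ (Fin n))
      = Module.finrank ℝ (EuclideanSpace ℝ (Fin n) × (EuclideanSpace ℝ (Fin n) →L[ℝ] ℝ)) := by
    rw [Module.finrank_prod, Module.finrank_prod, ← (LinearMap.toContinuousLinearMap
      (𝕜 := ℝ) (E := EuclideanSpace ℝ (Fin n)) (F' := ℝ)).finrank_eq, Module.finrank_linearMap]
    simp
  obtain ⟨A, hA⟩ := exists_equiv_of_injective D hinj hrank
  rw [← hA] at hD
  obtain ⟨r, hr0, hr, hright⟩ := exists_contDiffAt_localInverse hΨ hD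
  have hp0 : (a, θ a) = Ψ p := by
    have h := (hV a ha).symm.trans (hL.fundTensor_self_eq (p := (a, V a)) ha hV0)
    exact congrArg (Prod.mk a) h
  have hpair : ContDiffAt ℝ 1 (fun b => (b, θ b)) a := contDiffAt_id.prodMk hθ
  have hR : ContDiffAt ℝ 1 (fun b => r (b, θ b)) a := by
    refine ContDiffAt.comp (g := r) a ?_ hpair
    rw [hp0]
    exact hr.of_le (by simp)
  refine (contDiffAt_snd.comp a hR).congr_of_eventuallyEq ?_
  have h1 : ∀ᶠ b in 𝓝 a, Ψ (r (b, θ b)) = (b, θ b) :=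
    hpair.continuousAt.eventually (hp0 ▸ hright)
  -- Staying off the zero section is what lets `fibreDeriv` be read as the Legendre transformation.
  have h2 : ∀ᶠ b in 𝓝 a, r (b, θ b) ∈ U ×ˢ ({0}ᶜ : Set (EuclideanSpace ℝ (Fin n))) := by
    refine hR.continuousAt.eventually ?_
    beta_reduce
    rw [hp0, hr0]
    exact hΩ
  filter_upwards [h1, h2] with b hb1 hb2
  have h4 : (r (b, θ b)).1 = b := congrArg Prod.fst hb1
  have h5 : fibreDeriv L (r (b, θ b)) = θ b := congrArg Prod.snd hb1
  have hbU : b ∈ U := h4 ▸ hb2.1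
  rw [← hL.fundTensor_self_eq hb2.1 hb2.2, h4] at h5
  exact (hL.minkowski b hbU).legendre_injective ((hV b hbU).trans h5.symm)

/-! ### Charts -/

section Charts

variable {n : ℕ} {M : Type*} [TopologicalSpace M] [ChartedSpace (EuclideanSpace ℝ (Fin n)) M]
  {φ : OpenPartialHomeomorph M (EuclideanSpace ℝ (Fin n))}

theorem mdifferentiable_of_mem_maximalAtlas (hφ : φ ∈ IsManifold.maximalAtlas (𝓡 n) ∞ M) :
    φ.MDifferentiable (𝓡 n) (𝓡 n) :=
  ⟨(contMDiffOn_of_mem_maximalAtlas hφ).mdifferentiableOn (by simp),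
    (contMDiffOn_symm_of_mem_maximalAtlas hφ).mdifferentiableOn (by simp)⟩

/-- The coordinate frame: the vector of components `y` is sent to `yⁱ ∂/∂xⁱ`. -/
def frame (hφ : φ ∈ IsManifold.maximalAtlas (𝓡 n) ∞ M) {a : EuclideanSpace ℝ (Fin n)}
    (ha : a ∈ φ.target) : EuclideanSpace ℝ (Fin n) ≃L[ℝ] EuclideanSpace ℝ (Fin n) :=
  (mdifferentiable_of_mem_maximalAtlas hφ).symm.mfderiv ha

theorem differential_frame {u : M → ℝ} (hu : ContMDiff (𝓡 n) 𝓘(ℝ, ℝ) 2 u)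
    (hφ : φ ∈ IsManifold.maximalAtlas (𝓡 n) ∞ M) {a : EuclideanSpace ℝ (Fin n)}
    (ha : a ∈ φ.target) (v : EuclideanSpace ℝ (Fin n)) :
    differential u (φ.symm a) (frame hφ ha v) = fderiv ℝ (u ∘ φ.symm) a v := by
  have h := mfderiv_comp a ((hu (φ.symm a)).mdifferentiableAt (by simp))
    ((mdifferentiable_of_mem_maximalAtlas hφ).mdifferentiableAt_symm ha)
  rw [← mfderiv_eq_fderiv]
  exact (congrArg (fun A => A v) h).symm

theorem contDiffAt_comp_chart_symm {u : M → ℝ} (hu : ContMDiff (𝓡 n) 𝓘(ℝ, ℝ) 2 u)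
    (hφ : φ ∈ IsManifold.maximalAtlas (𝓡 n) ∞ M) {a : EuclideanSpace ℝ (Fin n)}
    (ha : a ∈ φ.target) : ContDiffAt ℝ 2 (u ∘ φ.symm) a := by
  rw [← contMDiffAt_iff_contDiffAt]
  exact (hu (φ.symm a)).comp a ((contMDiffAt_symm_of_mem_maximalAtlas hφ ha).of_le
    ENat.LEInfty.out)

variable [IsManifold (𝓡 n) ∞ M]

/-! ### The metric in a chart -/

theorem localMetric_eq (F : FinslerMetric n M) (hφ : φ ∈ IsManifold.maximalAtlas (𝓡 n) ∞ M)
    {a : EuclideanSpace ℝ (Fin n)} (ha : a ∈ φ.target) (y : EuclideanSpace ℝ (Fin n)) :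
    localMetric F φ (a, y) = F.toFun ⟨φ.symm a, frame hφ ha y⟩ :=
  rfl

/-- This is the tangent map of the inverse chart, after identifying the tangent bundle of ℝⁿ with a
product. -/
theorem contMDiffOn_frame (hφ : φ ∈ IsManifold.maximalAtlas (𝓡 n) ∞ M) :
    ContMDiffOn 𝓘(ℝ, EuclideanSpace ℝ (Fin n) × EuclideanSpace ℝ (Fin n)) (𝓡 n).tangent ∞
      (fun p : EuclideanSpace ℝ (Fin n) × EuclideanSpace ℝ (Fin n) =>
        (⟨φ.symm p.1, mfderiv (𝓡 n) (𝓡 n) φ.symm p.1 p.2⟩ : TangentBundle (𝓡 n) M))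
      (φ.target ×ˢ univ) := by
  have h1 := (contMDiffOn_symm_of_mem_maximalAtlas hφ).contMDiffOn_tangentMapWithin (m := ∞)
    (by simp) φ.open_target.uniqueMDiffOn
  have h2 : ContMDiff 𝓘(ℝ, EuclideanSpace ℝ (Fin n) × EuclideanSpace ℝ (Fin n)) (𝓡 n).tangent ∞
      (fun p : EuclideanSpace ℝ (Fin n) × EuclideanSpace ℝ (Fin n) =>
        (⟨p.1, p.2⟩ : TangentBundle (𝓡 n) (EuclideanSpace ℝ (Fin n)))) := by
    rw [modelWithCornersSelf_prod]
    exact contMDiff_tangentBundleModelSpaceHomeomorph_symm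
  have h4 := ContMDiffOn.comp (s := φ.target ×ˢ univ) h1 h2.contMDiffOn fun p hp => hp.1
  refine h4.congr fun p hp => ?_
  simp only [Function.comp_apply, tangentMapWithin]
  rw [mfderivWithin_of_isOpen φ.open_target hp.1]

theorem contDiffOn_localMetric (F : FinslerMetric n M)
    (hφ : φ ∈ IsManifold.maximalAtlas (𝓡 n) ∞ M) :
    ContDiffOn ℝ ∞ (localMetric F φ) (φ.target ×ˢ {0}ᶜ) := by
  rw [← contMDiffOn_iff_contDiffOn]
  refine F.smooth.comp ((contMDiffOn_frame hφ).mono (prod_mono_right (subset_univ _))) ?_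
  rintro ⟨a, y⟩ ⟨ha, hy⟩ h
  exact hy ((frame hφ ha).map_eq_zero_iff.1 h)

theorem isMinkowski_fibre (F : FinslerMetric n M) (x : M) :
    IsMinkowski fun z : EuclideanSpace ℝ (Fin n) => F.toFun ⟨x, z⟩ where
  nonneg _ := F.nonneg _
  homogeneous v c hc := F.homogeneous x v c hc
  posDef v w hv hw := F.posDef x v w hv hw
  smooth := by
    have hφ := IsManifold.chart_mem_maximalAtlas (I := 𝓡 n) (n := ∞) x
    set φ := chartAt (EuclideanSpace ℝ (Fin n)) x
    have hx : x ∈ φ.source := mem_chart_source _ x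
    have ha := φ.map_source hx
    -- Smoothness on the fibre is read off from the chart expression at fixed x, undoing the frame.
    have h1 : ContDiffOn ℝ ∞ (fun z => localMetric F φ (φ x, (frame hφ ha).symm z)) {0}ᶜ :=
      (contDiffOn_localMetric F hφ).comp
        (contDiff_const.prodMk (frame hφ ha).symm.contDiff).contDiffOn
        fun z hz => ⟨ha, fun h => hz ((frame hφ ha).symm.map_eq_zero_iff.1 h)⟩
    refine h1.congr fun z _ => ?_
    rw [localMetric_eq F hφ ha, ContinuousLinearEquiv.apply_symm_apply, φ.left_inv hx]

theorem isLocalFinsler_localMetric (F : FinslerMetric n M)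
    (hφ : φ ∈ IsManifold.maximalAtlas (𝓡 n) ∞ M) :
    IsLocalFinsler φ.target (localMetric F φ) where
  isOpen := φ.open_target
  smooth := contDiffOn_localMetric F hφ
  minkowski a ha := (isMinkowski_fibre F (φ.symm a)).comp_equiv (frame hφ ha)

/-! ### The gradient in a chart and the Hessian formula -/

theorem legendre_bijective (F : FinslerMetric n M) (x : M) : Function.Bijective (legendre F x) :=
  (isMinkowski_fibre F x).legendre_bijective

theorem legendre_gradient (F : FinslerMetric n M) (u : M → ℝ) (x : M) :
    legendre F x (gradient F u x) = differential u x :=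
  Function.invFun_eq ((legendre_bijective F x).2 _)

theorem frame_localGradient (F : FinslerMetric n M) (u : M → ℝ)
    (hφ : φ ∈ IsManifold.maximalAtlas (𝓡 n) ∞ M) {a : EuclideanSpace ℝ (Fin n)}
    (ha : a ∈ φ.target) : frame hφ ha (localGradient F u φ a) = gradient F u (φ.symm a) := by
  have h := (mdifferentiable_of_mem_maximalAtlas hφ).symm_comp_deriv (φ.map_target ha)
  rw [φ.right_inv ha] at h
  exact congrArg (fun A => A (gradient F u (φ.symm a))) h

theorem localGradient_ne_zero (F : FinslerMetric n M) {u : M → ℝ}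
    (hφ : φ ∈ IsManifold.maximalAtlas (𝓡 n) ∞ M) {x : M} (hx : x ∈ φ.source)
    (hdu : differential (n := n) u x ≠ 0) : localGradient F u φ (φ x) ≠ 0 := by
  intro h
  have h1 := frame_localGradient F u hφ (φ.map_source hx)
  rw [h, map_zero, φ.left_inv hx] at h1
  refine hdu ?_
  rw [← legendre_gradient F u x, ← h1]
  exact (isMinkowski_fibre F x).legendre_eq_zero_iff.2 rfl

/-- In coordinates, the gradient is Legendre dual to the differential. -/
theorem fundTensor_localGradient (F : FinslerMetric n M) {u : M → ℝ}
    (hu : ContMDiff (𝓡 n) 𝓘(ℝ, ℝ) 2 u) (hφ : φ ∈ IsManifold.maximalAtlas (𝓡 n) ∞ M)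
    {a : EuclideanSpace ℝ (Fin n)} (ha : a ∈ φ.target) :
    fundTensor (fun y => localMetric F φ (a, y)) (localGradient F u φ a) (localGradient F u φ a)
      = fderiv ℝ (u ∘ φ.symm) a := by
  ext v
  rw [← differential_frame hu hφ ha, ← legendre_gradient F u (φ.symm a)]
  -- The transformation rule for `fundTensor` holds only off the origin; at zero both sides vanish
  -- by linearity.
  by_cases h0 : localGradient F u φ a = 0
  · have h1 := frame_localGradient F u hφ ha
    rw [h0, map_zero] at h1
    have h2 : legendre F (φ.symm a) 0 = 0 :=
      (isMinkowski_fibre F (φ.symm a)).legendre_eq_zero_iff.2 rfl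
    rw [h0, map_zero, ← h1]
    exact (congrArg (fun A => A (frame hφ ha v)) h2).symm
  · have h1 := fundTensor_comp_equiv (isMinkowski_fibre F (φ.symm a)).smooth (frame hφ ha) h0
      (localGradient F u φ a) v
    rw [frame_localGradient] at h1
    exact h1

theorem contDiffAt_localGradient (F : FinslerMetric n M) {u : M → ℝ}
    (hu : ContMDiff (𝓡 n) 𝓘(ℝ, ℝ) 2 u) (hφ : φ ∈ IsManifold.maximalAtlas (𝓡 n) ∞ M) {x : M}
    (hx : x ∈ φ.source) (hdu : differential (n := n) u x ≠ 0) :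
    ContDiffAt ℝ 1 (localGradient F u φ) (φ x) :=
  (isLocalFinsler_localMetric F hφ).contDiffAt_of_legendre (φ.map_source hx)
    (localGradient_ne_zero F hφ hx hdu)
    ((contDiffAt_comp_chart_symm hu hφ (φ.map_source hx)).fderiv_right (by norm_num))
    fun _ hb => fundTensor_localGradient F hu hφ hb

/-- Near x the gradient is the smooth frame map applied to its C¹ coordinate expression. -/
theorem contMDiffOn_gradient (F : FinslerMetric n M) {u : M → ℝ}
    (hu : ContMDiff (𝓡 n) 𝓘(ℝ, ℝ) 2 u) :
    ContMDiffOn (𝓡 n) (𝓡 n).tangent 1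
      (fun x => (⟨x, gradient F u x⟩ : TangentBundle (𝓡 n) M))
      {x : M | differential (n := n) u x ≠ 0} := by
  intro x hdu
  refine ContMDiffAt.contMDiffWithinAt ?_
  have hφ := IsManifold.chart_mem_maximalAtlas (I := 𝓡 n) (n := ∞) x
  set φ := chartAt (EuclideanSpace ℝ (Fin n)) x
  have hx : x ∈ φ.source := mem_chart_source _ x
  have h1 : ContMDiffAt (𝓡 n) 𝓘(ℝ, EuclideanSpace ℝ (Fin n) × EuclideanSpace ℝ (Fin n)) 1
      (fun z => (φ z, localGradient F u φ (φ z))) x := by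
    have h2 : ContDiffAt ℝ 1 (fun a => (a, localGradient F u φ a)) (φ x) :=
      contDiffAt_id.prodMk (contDiffAt_localGradient F hu hφ hx hdu)
    exact h2.contMDiffAt.comp x ((contMDiffAt_of_mem_maximalAtlas hφ hx).of_le (by simp))
  have h3 := ((contMDiffOn_frame hφ).contMDiffAt (x := (φ x, localGradient F u φ (φ x)))
    ((φ.open_target.prod isOpen_univ).mem_nhds ⟨φ.map_source hx, mem_univ _⟩)).of_le
    (show (1 : WithTop ℕ∞) ≤ ∞ by simp)
  refine (ContMDiffAt.comp x h3 h1).congr_of_eventuallyEq ?_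
  filter_upwards [φ.open_source.mem_nhds hx] with z hz
  have h4 := frame_localGradient F u hφ (φ.map_source hz)
  have h5 : (⟨φ.symm (φ z), gradient F u (φ.symm (φ z))⟩ : TangentBundle (𝓡 n) M)
      = ⟨z, gradient F u z⟩ := by rw [φ.left_inv hz]
  rw [← h5, ← h4]
  rfl

theorem hess_eq (F : FinslerMetric n M) {u : M → ℝ} (hu : ContMDiff (𝓡 n) 𝓘(ℝ, ℝ) 2 u)
    (hφ : φ ∈ IsManifold.maximalAtlas (𝓡 n) ∞ M) {x : M} (hx : x ∈ φ.source)
    (hdu : differential (n := n) u x ≠ 0) :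
    hess F u φ x = (1 / 2 : ℝ) • lieGradMatrix F u φ x - cartanGradMatrix F u φ x := by
  have hL := isLocalFinsler_localMetric F hφ
  have ha := φ.map_source hx
  have hV0 := localGradient_ne_zero F hφ hx hdu
  have hV := contDiffAt_localGradient F hu hφ hx hdu
  -- Continuity keeps the gradient nonzero near x, where `fibreDeriv` represents the Legendre
  -- transformation.
  have hdual : ∀ᶠ b in 𝓝 (φ x),
      fderiv ℝ (u ∘ φ.symm) b = fibreDeriv (localMetric F φ) (b, localGradient F u φ b) := by
    filter_upwards [φ.open_target.mem_nhds ha, hV.continuousAt.eventually_ne hV0] with b hb hb0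
    rw [← fundTensor_localGradient F hu hφ hb]
    exact hL.fundTensor_self_eq (p := (b, localGradient F u φ b)) hb hb0
  ext i j
  exact hL.secondCov_eq_lieG ha hV0 (hV.differentiableAt (by simp))
    (contDiffAt_comp_chart_symm hu hφ ha) hdual i j

end Charts

end Finsler

end

theorem proposition5p3 {n : ℕ} {M : Type*} [TopologicalSpace M]
    [ChartedSpace (EuclideanSpace ℝ (Fin n)) M] [IsManifold (𝓡 n) ∞ M]
    (F : Finsler.FinslerMetric n M) (u : M → ℝ) (hu : ContMDiff (𝓡 n) 𝓘(ℝ, ℝ) 2 u) :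
    (∀ x : M, Function.Bijective (Finsler.legendre F x)) ∧
    ContMDiffOn (𝓡 n) (𝓡 n).tangent 1
      (fun x => (⟨x, Finsler.gradient F u x⟩ : TangentBundle (𝓡 n) M))
      {x : M | Finsler.differential (n := n) u x ≠ 0} ∧
    ∀ φ ∈ IsManifold.maximalAtlas (𝓡 n) ∞ M, ∀ x ∈ φ.source, Finsler.differential (n := n) u x ≠ 0 →
      Finsler.hess F u φ x =
        (1 / 2 : ℝ) • Finsler.lieGradMatrix F u φ x - Finsler.cartanGradMatrix F u φ x :=
  ⟨Finsler.legendre_bijective F, Finsler.contMDiffOn_gradient F hu,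
    fun _ hφ _ hx hdu => Finsler.hess_eq F hu hφ hx hdu⟩
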